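/- Let $d\in\{1,2\}$ and let $\Omega\subset\mathbb{R}^d$ be a bounded convex polygonal domain (a bounded open interval if $d=1$). Let $H\subseteq(0,1)$ (for instance a sequence of mesh sizes) and let $\{\mathcal T_h\}_{h\in H}$ be a regular family of triangulations of $\Omega$: each $\mathcal T_h$ is a finite conforming decomposition of $\overline\Omega$ into closed nondegenerate $d$-simplices, $h$ is the maximum diameter of its elements, and there is $\sigma>0$, independent of $h$, such that every element $K\in\mathcal T_h$, $h\in H$, contains a ball of radius $\sigma\,\mathrm{diam}(K)$. Put $$X_h^1=\{v\in C(\overline\Omega) : v|_K \text{ is affine for all } K\in\mathcal T_h\},$$ $$TV(f)=\sup\Big\{\int_\Omega f\,\mathrm{div}\rho\,dx : \rho\in C_c^1(\Omega)^d,\ |\rho(x)|\le 1 \text{ for all } x\Big\},$$ with $|\cdot|$ the Euclidean norm, and $BV(\Omega)=\{f\in L^1(\Omega): TV(f)<\infty\}$. Assume that $f\in BV(\Omega)\cap L^\infty(\Omega)$. Then: (i) There is a constant $c>0$, independent of $h$ and $p$, such that for all $1\le p<\infty$ and $h\in H$ there exists $\widehat f_h\in X_h^1$ with $$\|\widehat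 f_h-f\|_{L^p(\Omega)}\le c\,h^{\frac1{p+1}}\quad\text{and}\quad TV(\widehat f_h)-TV(f)\le c\,h^{\frac1{p+1}}.$$ (ii) For every $h_0\in(0,1)$ there is a constant $c>0$, independent of $h$ and $p$, such that for all $1\le p<\infty$ there are $\widehat f_h\in X_h^1$, $h\in H$, with $$\|\widehat f_h-f\|_{L^p(\Omega)}\le c\,(h|\ln h|)^{\frac1p}\ \text{ for all } h\in H,\ h\le h_0,\quad\text{and}\quad \lim_{H\ni h\to0}TV(\widehat f_h)=TV(f)$$ (the limit statement being void if $0$ is not an accumulation point of $H$). -/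

import Mathlib

open MeasureTheory Filter Topology
open scoped ENNReal

namespace BVApprox

/-- A convex polygonal domain: the nonempty interior of the convex hull of finitely many points.
In dimension one it is a bounded open interval, in dimension two an open convex polygon. -/
def IsConvexPolygonalDomain {d : ℕ} (Ω : Set (EuclideanSpace ℝ (Fin d))) : Prop :=
  Ω.Nonempty ∧ ∃ S : Finset (EuclideanSpace ℝ (Fin d)),
    Ω = interior (convexHull ℝ (S : Set (EuclideanSpace ℝ (Fin d))))

/-- The divergence of a vector field. -/
noncomputable def div {d : ℕ} (ρ : EuclideanSpace ℝ (Fin d) → EuclideanSpace ℝ (Fin d))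
    (x : EuclideanSpace ℝ (Fin d)) : ℝ :=
  ∑ i : Fin d, (fderiv ℝ ρ x (EuclideanSpace.single i 1)) i

/-- The test fields for the total variation: `C¹` vector fields with compact support in `Ω`
(extended by zero) whose Euclidean norm is at most one everywhere. -/
def testFields {d : ℕ} (Ω : Set (EuclideanSpace ℝ (Fin d))) :
    Set (EuclideanSpace ℝ (Fin d) → EuclideanSpace ℝ (Fin d)) :=
  {ρ | ContDiff ℝ 1 ρ ∧ HasCompactSupport ρ ∧ tsupport ρ ⊆ Ω ∧ ∀ x, ‖ρ x‖ ≤ 1}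

/-- The total variation of `f` in `Ω`, with values in `[0, ∞]`. The set of test fields
contains `0`, so that cutting the integrals off at zero does not change the supremum. -/
noncomputable def TV {d : ℕ} (Ω : Set (EuclideanSpace ℝ (Fin d)))
    (f : EuclideanSpace ℝ (Fin d) → ℝ) : ℝ≥0∞ :=
  ⨆ ρ ∈ testFields Ω, ENNReal.ofReal (∫ x in Ω, f x * div ρ x)

/-- `f ∈ BV(Ω)`: integrable on `Ω` and of finite total variation. -/
def MemBV {d : ℕ} (Ω : Set (EuclideanSpace ℝ (Fin d)))
    (f : EuclideanSpace ℝ (Fin d) → ℝ) : Prop :=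
  IntegrableOn f Ω ∧ TV Ω f ≠ ∞

/-- A (conforming) triangulation of `Ω`: a finite simplicial complex that covers exactly the closure
of `Ω`, all of whose faces are faces of nondegenerate `d`-simplices of the complex. -/
structure Triangulation {d : ℕ} (Ω : Set (EuclideanSpace ℝ (Fin d))) extends
    Geometry.SimplicialComplex ℝ (EuclideanSpace ℝ (Fin d)) where
  finite_faces : faces.Finite
  pure : ∀ s ∈ faces, ∃ t ∈ faces, s ⊆ t ∧ t.card = d + 1
  space_eq : toSimplicialComplex.space = closure Ω

/-- The elements of a triangulation: the closed `d`-simplices of the complex. -/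
def Triangulation.elements {d : ℕ} {Ω : Set (EuclideanSpace ℝ (Fin d))} (T : Triangulation Ω) :
    Set (Set (EuclideanSpace ℝ (Fin d))) :=
  {K | ∃ s ∈ T.faces, s.card = d + 1 ∧ K = convexHull ℝ (s : Set (EuclideanSpace ℝ (Fin d)))}

/-- A regular family of triangulations of `Ω`, indexed by a set `H ⊆ (0, 1)` of mesh sizes:
the largest diameter of an element of `T h` is `h`, and the family is shape regular, that is, each
element `K` contains a ball of radius `σ * diam K`, with one `σ > 0` for the whole family.
The values of `T` outside `H` play no role. -/
structure IsRegularFamily {d : ℕ} {Ω : Set (EuclideanSpace ℝ (Fin d))} (H : Set ℝ)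
    (T : ℝ → Triangulation Ω) : Prop where
  subset_Ioo : H ⊆ Set.Ioo 0 1
  meshSize : ∀ h ∈ H, IsGreatest (Metric.diam '' (T h).elements) h
  shapeRegular : ∃ σ : ℝ, 0 < σ ∧ ∀ h ∈ H, ∀ K ∈ (T h).elements,
    ∃ x, Metric.closedBall x (σ * Metric.diam K) ⊆ K

/-- The finite element space of continuous piecewise affine functions on the closure of `Ω`. -/
def P1Space {d : ℕ} {Ω : Set (EuclideanSpace ℝ (Fin d))} (T : Triangulation Ω) :
    Set (EuclideanSpace ℝ (Fin d) → ℝ) :=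
  {v | ContinuousOn v (closure Ω) ∧
    ∀ K ∈ T.elements, ∃ g : EuclideanSpace ℝ (Fin d) →ᵃ[ℝ] ℝ, Set.EqOn v g K}

end BVApprox

/-!
Approximation of a bounded function `f` of bounded variation by continuous piecewise affine
functions, with rates in `L^p` and almost without increasing the total variation.

The approximation is the nodal interpolant of a mollification of `f` at a scale `ε` larger than the
mesh size `h`. As `f` is only defined on `Ω`, it is first dilated by the factor `(1 - β)⁻¹` from an
interior point `x₀`, with `β` a multiple of `ε`; since `Ω` is convex, the mollification `u` of the
dilated function `F` at scale `ε` then only involves values of `f` in `Ω`.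

Everything is controlled by one quantity, the local oscillation
`A x = ∫_{|w| < 2 ε} |F (x + w) - f x| dw`. For fixed `w`, the map
`x ↦ (1 - β) (x + w) + β x₀` is a contraction of `Ω` into itself which moves points by `O(ε)`, and
such a contraction `φ` satisfies `∫_Ω |f ∘ φ - f| ≤ C ε TV(f)`
(`IsBoundedBV.setIntegral_abs_comp_sub_le`): test with a compactly supported `ψ`, join `φ` to the
identity by affine maps `φ_t`, and observe that the `t`-derivative of `∫ (f ∘ φ_t) ψ` is an integral
`∫ f div ρ_t`. Hence `∫_Ω A ≤ C ε ^ (d + 1) TV(f)` (`IsBoundedBV.setIntegral_oscillation_le`).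
On the other hand, the derivatives of the mollification kernel have vanishing integral, so that near
`x` one has `|u - f x| ≤ C ε ^ (-d) A x`, and the gradient of `u` is Lipschitz with constant
`C ε ^ (-d - 2) A x`.

The first bound passes to the interpolant `v`, because the values of `v` on an element are convex
combinations of values of `u` at its vertices, and gives `∫_Ω |v - f| ≤ C ε`. The second one bounds
the gradient of `v - u` by `C h ε ^ (-d - 2) A x` on shape regular elements
(`norm_fderiv_sub_linear_le`), and therefore `TV(v) ≤ TV(u) + C h / ε`
(`IsInterpolant.integral_mul_div_le`). Finally `TV(u) ≤ (1 - β) ^ (-d) TV(f) ≤ TV(f) + C ε`, since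
`u` is an average of pull-backs of `f` along contractions of `Ω`
(`IsBoundedBV.integral_mollify_mul_div_le`).

As all functions are bounded, the `L¹` estimate yields `‖v - f‖_p ≤ C ε ^ (1 / p)`. The choice
`ε = h ^ (p / (p + 1))` balances both errors; the choice `ε = h |log h|` gives the second
statement, where `h / ε → 0`, together with the lower semicontinuity of the total variation.
-/


namespace BVApprox

variable {d : ℕ} {Ω : Set (EuclideanSpace ℝ (Fin d))}

/-! ### Divergence, test fields and the total variation -/

lemma div_const_smul (c : ℝ) (ρ : EuclideanSpace ℝ (Fin d) → EuclideanSpace ℝ (Fin d))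
    (x : EuclideanSpace ℝ (Fin d)) : div (c • ρ) x = c * div ρ x := by
  simp [div, fderiv_const_smul_field, Finset.mul_sum]

lemma div_neg (ρ : EuclideanSpace ℝ (Fin d) → EuclideanSpace ℝ (Fin d))
    (x : EuclideanSpace ℝ (Fin d)) : div (-ρ) x = - div ρ x := by
  simpa using div_const_smul (-1) ρ x

lemma continuous_div {ρ : EuclideanSpace ℝ (Fin d) → EuclideanSpace ℝ (Fin d)}
    (hρ : ContDiff ℝ 1 ρ) : Continuous (div ρ) := by
  have h := hρ.continuous_fderiv one_ne_zero
  unfold div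
  fun_prop

lemma div_eq_zero_of_notMem {ρ : EuclideanSpace ℝ (Fin d) → EuclideanSpace ℝ (Fin d)}
    {x : EuclideanSpace ℝ (Fin d)} (hx : x ∉ tsupport ρ) : div ρ x = 0 := by
  have : fderiv ℝ ρ x = 0 := by
    by_contra h
    exact hx (support_fderiv_subset ℝ h)
  simp [div, this]

lemma hasCompactSupport_div {ρ : EuclideanSpace ℝ (Fin d) → EuclideanSpace ℝ (Fin d)}
    (hρ : HasCompactSupport ρ) : HasCompactSupport (div ρ) :=
  HasCompactSupport.intro hρ fun _ hx => div_eq_zero_of_notMem hx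

lemma exists_abs_div_le {ρ : EuclideanSpace ℝ (Fin d) → EuclideanSpace ℝ (Fin d)}
    (hρ : ContDiff ℝ 1 ρ) (hc : HasCompactSupport ρ) : ∃ C, ∀ x, |div ρ x| ≤ C :=
  (hasCompactSupport_div hc).exists_bound_of_continuous (continuous_div hρ)

/-- The homeomorphism `y ↦ μ⁻¹ • (y - b)`, inverse to `x ↦ μ • x + b`. -/
noncomputable def invAffine (μ : ℝ) (hμ : μ ≠ 0) (b : EuclideanSpace ℝ (Fin d)) :
    EuclideanSpace ℝ (Fin d) ≃ₜ EuclideanSpace ℝ (Fin d) :=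
  (Homeomorph.subRight b).trans (Homeomorph.smulOfNeZero μ⁻¹ (inv_ne_zero hμ))

lemma invAffine_apply (μ : ℝ) (hμ : μ ≠ 0) (b y : EuclideanSpace ℝ (Fin d)) :
    invAffine μ hμ b y = μ⁻¹ • (y - b) := rfl

lemma smul_invAffine_add (μ : ℝ) (hμ : μ ≠ 0) (b y : EuclideanSpace ℝ (Fin d)) :
    μ • invAffine μ hμ b y + b = y := by
  simp [invAffine_apply, smul_smul, hμ]

lemma invAffine_smul_add (μ : ℝ) (hμ : μ ≠ 0) (b x : EuclideanSpace ℝ (Fin d)) :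
    invAffine μ hμ b (μ • x + b) = x := by
  simp [invAffine_apply, smul_smul, hμ]

lemma contDiff_invAffine (μ : ℝ) (hμ : μ ≠ 0) (b : EuclideanSpace ℝ (Fin d)) :
    ContDiff ℝ 1 (invAffine μ hμ b) := by
  change ContDiff ℝ 1 (fun y => μ⁻¹ • (y - b))
  fun_prop

lemma div_comp_invAffine (μ : ℝ) (hμ : μ ≠ 0) (b : EuclideanSpace ℝ (Fin d))
    {ρ : EuclideanSpace ℝ (Fin d) → EuclideanSpace ℝ (Fin d)} (hρ : ContDiff ℝ 1 ρ)
    (y : EuclideanSpace ℝ (Fin d)) :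
    div (ρ ∘ invAffine μ hμ b) y = μ⁻¹ * div ρ (invAffine μ hμ b y) := by
  have h1 : HasFDerivAt (invAffine μ hμ b)
      (μ⁻¹ • ContinuousLinearMap.id ℝ (EuclideanSpace ℝ (Fin d))) y := by
    change HasFDerivAt (fun y => μ⁻¹ • (y - b)) _ y
    exact ((hasFDerivAt_id y).sub_const b).const_smul μ⁻¹
  have h2 := (hρ.differentiable one_ne_zero (invAffine μ hμ b y)).hasFDerivAt.comp y h1
  simp [div, h2.fderiv, Finset.mul_sum]

lemma integral_comp_smul_add {μ : ℝ} (hμ : 0 < μ) (b : EuclideanSpace ℝ (Fin d))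
    (G : EuclideanSpace ℝ (Fin d) → ℝ) :
    ∫ x, G (μ • x + b) = (μ ^ d)⁻¹ * ∫ y, G y := by
  rw [Measure.integral_comp_smul volume (fun x => G (x + b)) μ, integral_add_right_eq_self]
  rw [abs_of_pos (by positivity)]
  simp

lemma tsupport_comp_invAffine_subset {F : Type*} [Zero F] {μ : ℝ} (hμ : μ ≠ 0)
    {b : EuclideanSpace ℝ (Fin d)} (hΩ : ∀ x ∈ Ω, μ • x + b ∈ Ω)
    {ρ : EuclideanSpace ℝ (Fin d) → F} (hρ : tsupport ρ ⊆ Ω) :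
    tsupport (ρ ∘ invAffine μ hμ b) ⊆ Ω := by
  rw [tsupport_comp_eq_preimage]
  intro y hy
  have := hΩ _ (hρ hy)
  rwa [smul_invAffine_add] at this

/-- The inequality defining the total variation, for a field of arbitrary size. -/
lemma integral_mul_div_le {f : EuclideanSpace ℝ (Fin d) → ℝ} (hTV : TV Ω f ≠ ∞)
    {ρ : EuclideanSpace ℝ (Fin d) → EuclideanSpace ℝ (Fin d)} (h1 : ContDiff ℝ 1 ρ)
    (h2 : HasCompactSupport ρ) (h3 : tsupport ρ ⊆ Ω) {N : ℝ} (hN : 0 < N)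
    (h4 : ∀ x, ‖ρ x‖ ≤ N) :
    ∫ x in Ω, f x * div ρ x ≤ N * (TV Ω f).toReal := by
  have hmem : N⁻¹ • ρ ∈ testFields Ω := by
    refine ⟨contDiff_const.smul h1, h2.smul_left (f := fun _ => N⁻¹), ?_, fun x => ?_⟩
    · exact (closure_mono (Function.support_const_smul_subset _ _)).trans h3
    · rw [Pi.smul_apply, norm_smul, norm_inv, Real.norm_of_nonneg hN.le, inv_mul_le_iff₀ hN]
      simpa using h4 x
  have h5 : ENNReal.ofReal (∫ x in Ω, f x * div (N⁻¹ • ρ) x) ≤ TV Ω f :=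
    le_iSup₂ (f := fun ρ (_ : ρ ∈ testFields Ω) => ENNReal.ofReal (∫ x in Ω, f x * div ρ x)) _ hmem
  have h6 := (ENNReal.ofReal_le_iff_le_toReal hTV).1 h5
  simp_rw [div_const_smul, mul_left_comm _ N⁻¹] at h6
  rw [integral_const_mul, inv_mul_le_iff₀ hN] at h6
  exact h6

lemma abs_integral_mul_div_le {f : EuclideanSpace ℝ (Fin d) → ℝ} (hTV : TV Ω f ≠ ∞)
    {ρ : EuclideanSpace ℝ (Fin d) → EuclideanSpace ℝ (Fin d)} (h1 : ContDiff ℝ 1 ρ)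
    (h2 : HasCompactSupport ρ) (h3 : tsupport ρ ⊆ Ω) {N : ℝ} (hN : 0 < N)
    (h4 : ∀ x, ‖ρ x‖ ≤ N) :
    |∫ x in Ω, f x * div ρ x| ≤ N * (TV Ω f).toReal := by
  refine abs_le.2 ⟨?_, integral_mul_div_le hTV h1 h2 h3 hN h4⟩
  have h5 := integral_mul_div_le hTV (ρ := -ρ) h1.neg h2.neg
    (by rwa [tsupport, Function.support_neg]) hN (by simpa using h4)
  simp_rw [div_neg, mul_neg, integral_neg] at h5
  linarith

/-- The total variation only depends on the function up to null sets. -/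
lemma TV_congr {f g : EuclideanSpace ℝ (Fin d) → ℝ} (h : f =ᵐ[volume.restrict Ω] g) :
    TV Ω f = TV Ω g := by
  refine iSup_congr fun ρ => iSup_congr fun _ => congrArg _ (integral_congr_ae ?_)
  filter_upwards [h] with x hx
  rw [hx]

lemma TV_le_ofReal {f : EuclideanSpace ℝ (Fin d) → ℝ} {B : ℝ}
    (h : ∀ ρ ∈ testFields Ω, ∫ x in Ω, f x * div ρ x ≤ B) : TV Ω f ≤ ENNReal.ofReal B :=
  iSup₂_le fun ρ hρ => ENNReal.ofReal_le_ofReal (h ρ hρ)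

lemma setIntegral_eq_integral_of_zero {f g : EuclideanSpace ℝ (Fin d) → ℝ}
    (hf : ∀ x ∉ Ω, f x = 0) : ∫ x in Ω, f x * g x = ∫ x, f x * g x :=
  setIntegral_eq_integral_of_forall_compl_eq_zero fun x hx => by simp [hf x hx]

/-- Pulling back a function of bounded variation along a contraction `x ↦ μ • x + b` which maps
the domain into itself changes its total variation at most by the factor `μ ^ (1 - d)`; only the
weaker factor `μ ^ (-d)` is recorded. -/
lemma integral_comp_smul_add_mul_div_le {f : EuclideanSpace ℝ (Fin d) → ℝ}
    (hf0 : ∀ x ∉ Ω, f x = 0) (hTV : TV Ω f ≠ ∞) {μ : ℝ} (hμ : 0 < μ) (hμ1 : μ ≤ 1)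
    {b : EuclideanSpace ℝ (Fin d)} (hΩ : ∀ x ∈ Ω, μ • x + b ∈ Ω)
    {ρ : EuclideanSpace ℝ (Fin d) → EuclideanSpace ℝ (Fin d)} (hρ : ρ ∈ testFields Ω) :
    ∫ x, f (μ • x + b) * div ρ x ≤ (μ ^ d)⁻¹ * (TV Ω f).toReal := by
  obtain ⟨h1, h2, h3, h4⟩ := hρ
  have e := integral_comp_smul_add hμ b (fun y => f y * div ρ (invAffine μ hμ.ne' b y))
  simp only [invAffine_smul_add] at e
  rw [e]
  gcongr
  have h5 := integral_mul_div_le hTV (ρ := ρ ∘ invAffine μ hμ.ne' b)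
    (h1.comp (contDiff_invAffine μ hμ.ne' b)) (h2.comp_homeomorph _)
    (tsupport_comp_invAffine_subset hμ.ne' hΩ h3) one_pos (fun x => h4 _)
  simp_rw [div_comp_invAffine μ hμ.ne' b h1, mul_left_comm _ μ⁻¹] at h5
  rw [integral_const_mul, inv_mul_le_iff₀ hμ, one_mul, setIntegral_eq_integral_of_zero hf0] at h5
  refine h5.trans (mul_le_of_le_one_left ENNReal.toReal_nonneg hμ1)

/-! ### The `L¹` modulus of continuity along contractions of the domain -/

/-- The field `ψ V`, where `V x = b - β • x` is the velocity of `x ↦ x + t • (b - β • x)`. -/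
noncomputable def transportField (ψ : EuclideanSpace ℝ (Fin d) → ℝ) (β : ℝ)
    (b : EuclideanSpace ℝ (Fin d)) (x : EuclideanSpace ℝ (Fin d)) : EuclideanSpace ℝ (Fin d) :=
  ψ x • (b - β • x)

lemma contDiff_transportField {ψ : EuclideanSpace ℝ (Fin d) → ℝ} (hψ : ContDiff ℝ 1 ψ) (β : ℝ)
    (b : EuclideanSpace ℝ (Fin d)) : ContDiff ℝ 1 (transportField ψ β b) := by
  unfold transportField
  fun_prop

lemma tsupport_transportField_subset (ψ : EuclideanSpace ℝ (Fin d) → ℝ) (β : ℝ)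
    (b : EuclideanSpace ℝ (Fin d)) : tsupport (transportField ψ β b) ⊆ tsupport ψ :=
  closure_mono (Function.support_smul_subset_left ψ fun x => b - β • x)

lemma div_transportField {ψ : EuclideanSpace ℝ (Fin d) → ℝ} (hψ : ContDiff ℝ 1 ψ) (β : ℝ)
    (b x : EuclideanSpace ℝ (Fin d)) :
    div (transportField ψ β b) x = fderiv ℝ ψ x (b - β • x) - d * β * ψ x := by
  have h1 : HasFDerivAt (fun x => b - β • x)
      (-(β • ContinuousLinearMap.id ℝ (EuclideanSpace ℝ (Fin d)))) x :=
    ((hasFDerivAt_id x).const_smul β).const_sub b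
  have h2 := (hψ.differentiable one_ne_zero x).hasFDerivAt.smul h1
  have h3 : fderiv ℝ (transportField ψ β b) x = _ := h2.fderiv
  have h4 : ∀ v : EuclideanSpace ℝ (Fin d),
      fderiv ℝ ψ x v = ∑ i, fderiv ℝ ψ x (EuclideanSpace.single i 1) * v i := by
    intro v
    conv_lhs => rw [← (EuclideanSpace.basisFun (Fin d) ℝ).sum_repr v]
    simp [map_sum, mul_comm]
  rw [h4, div, h3]
  simp [Finset.sum_add_distrib]
  ring

/-- Transport along the segment of maps from the identity to a contraction of the domain: the
function `t ↦ ∫ f (φ_t x) ψ x dx`, where `φ_t x = x + t • (b - β • x)`, has a derivative of the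
form `∫ f div ρ_t`, and is therefore Lipschitz with the total variation of `f` in its constant. -/
lemma abs_integral_comp_sub_mul_le {f : EuclideanSpace ℝ (Fin d) → ℝ} (hfi : Integrable f)
    (hf0 : ∀ x ∉ Ω, f x = 0) (hTV : TV Ω f ≠ ∞) (hconv : Convex ℝ Ω)
    {β : ℝ} (hβ0 : 0 ≤ β) (hβ1 : β ≤ 1 / 4)
    {b : EuclideanSpace ℝ (Fin d)} (hΩ : ∀ x ∈ Ω, x + (b - β • x) ∈ Ω)
    {N : ℝ} (hN : 0 < N) (hNle : ∀ x ∈ Ω, ‖b - β • x‖ ≤ N)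
    {ψ : EuclideanSpace ℝ (Fin d) → ℝ} (h1 : ContDiff ℝ 1 ψ) (h2 : HasCompactSupport ψ)
    (h3 : tsupport ψ ⊆ Ω) (h4 : ∀ x, |ψ x| ≤ 1) :
    |(∫ x, f (x + (b - β • x)) * ψ x) - ∫ x, f x * ψ x| ≤
      ((1 - β) ^ d)⁻¹ * N * (TV Ω f).toReal := by
  set m : ℝ → ℝ := fun t => 1 - t * β with hm
  have hmpos : ∀ t ∈ Set.Ioo (-1 : ℝ) 2, 1 / 2 ≤ m t := fun t ht => by
    simp only [hm]; nlinarith [ht.1, ht.2]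
  set θ : ℝ → EuclideanSpace ℝ (Fin d) → EuclideanSpace ℝ (Fin d) :=
    fun t y => (m t)⁻¹ • (y - t • b) with hθ
  set q := div (transportField ψ β b) with hq
  have hqc : Continuous q := continuous_div (contDiff_transportField h1 β b)
  have hcs : HasCompactSupport (transportField ψ β b) :=
    h2.of_isClosed_subset (isClosed_tsupport _) (tsupport_transportField_subset ψ β b)
  obtain ⟨C, hC⟩ := exists_abs_div_le (contDiff_transportField h1 β b) hcs
  have hC0 : 0 ≤ C := (abs_nonneg _).trans (hC 0)
  -- the integrand after the substitution `y = φ_t x`, and its derivative in `t`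
  set J : ℝ → EuclideanSpace ℝ (Fin d) → ℝ := fun t y => f y * ((m t ^ d)⁻¹ * ψ (θ t y)) with hJ
  set J' : ℝ → EuclideanSpace ℝ (Fin d) → ℝ :=
    fun t y => f y * (-((m t ^ d)⁻¹ * (m t)⁻¹) * q (θ t y)) with hJ'
  have hθc : ∀ t, Continuous (θ t) := fun t => by simp only [hθ]; fun_prop
  have hderiv : ∀ t ∈ Set.Ioo (-1 : ℝ) 2, ∀ y, HasDerivAt (fun s => J s y) (J' t y) t := by
    intro t ht y
    have hmt : 0 < m t := by linarith [hmpos t ht]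
    have hdm : HasDerivAt m (-β) t := by
      simpa [hm] using ((hasDerivAt_id t).mul_const β).const_sub 1
    have hinv : HasDerivAt (fun s => (m s)⁻¹) (β * ((m t)⁻¹ * (m t)⁻¹)) t := by
      refine (hdm.inv hmt.ne').congr_deriv ?_
      rw [neg_neg]
      field_simp
    have hpow : HasDerivAt (fun s => (m s ^ d)⁻¹) (d * β * ((m t ^ d)⁻¹ * (m t)⁻¹)) t := by
      have := hinv.pow d
      have e : (fun s => (m s ^ d)⁻¹) = (fun s => (m s)⁻¹) ^ d := by
        ext s; simp
      rw [e]
      refine this.congr_deriv ?_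
      clear * -
      rcases d with _ | n
      · simp
      · simp only [Nat.add_sub_cancel, pow_succ, mul_inv, inv_pow]
        ring
    have hdθ : HasDerivAt (fun s => θ s y) (-((m t)⁻¹ • (b - β • θ t y))) t := by
      have h5 : HasDerivAt (fun s : ℝ => y - s • b) (-b) t := by
        simpa using ((hasDerivAt_id t).smul_const b).const_sub y
      have := hinv.smul h5
      refine this.congr_deriv ?_
      simp only [hθ]
      module
    have hψd := (h1.differentiable one_ne_zero (θ t y)).hasFDerivAt.comp_hasDerivAt t hdθ
    refine ((hpow.mul hψd).const_mul (f y)).congr_deriv ?_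
    simp only [hJ', hq, div_transportField h1, map_neg, map_smul, smul_eq_mul, Function.comp]
    ring
  have hbound : ∀ t ∈ Set.Ioo (-1 : ℝ) 2, ∀ y, ‖J' t y‖ ≤ |f y| * ((2 ^ d * 2) * C) := by
    intro t ht y
    have hmt := hmpos t ht
    have h5 : (m t)⁻¹ ≤ 2 := by
      rw [inv_le_comm₀ (by linarith) two_pos]; linarith
    have h6 : 0 ≤ (m t)⁻¹ := by rw [inv_nonneg]; linarith
    simp only [hJ', norm_mul, Real.norm_eq_abs, abs_neg, abs_mul]
    rw [← inv_pow, abs_pow, abs_of_nonneg h6]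
    gcongr
    exact hC _
  have hDeriv : ∀ t ∈ Set.Icc (0 : ℝ) 1, HasDerivAt (fun s => ∫ y, J s y) (∫ y, J' t y) t := by
    intro t ht
    have ht' : t ∈ Set.Ioo (-1 : ℝ) 2 := ⟨by linarith [ht.1], by linarith [ht.2]⟩
    have hψc := h1.continuous
    refine (hasDerivAt_integral_of_dominated_loc_of_deriv_le
      (bound := fun y => |f y| * ((2 ^ d * 2) * C)) (isOpen_Ioo.mem_nhds ht') ?_ ?_ ?_ ?_ ?_ ?_).2
    · refine Eventually.of_forall fun s => hfi.1.mul ?_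
      exact (((hψc.comp (hθc s)).const_mul _).aestronglyMeasurable)
    · refine hfi.mul_bdd (c := |(m t ^ d)⁻¹| * 1)
        ((hψc.comp (hθc t)).const_mul _).aestronglyMeasurable (Eventually.of_forall fun y => ?_)
      rw [norm_mul, Real.norm_eq_abs, Real.norm_eq_abs]
      gcongr
      exact h4 _
    · exact hfi.1.mul ((hqc.comp (hθc t)).const_mul _).aestronglyMeasurable
    · exact Eventually.of_forall fun y s hs => hbound s hs y
    · exact hfi.abs.mul_const _
    · exact Eventually.of_forall fun y s hs => hderiv s hs y
  have hnorm : ∀ t ∈ Set.Icc (0 : ℝ) 1,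
      ‖∫ y, J' t y‖ ≤ ((1 - β) ^ d)⁻¹ * N * (TV Ω f).toReal := by
    intro t ht
    have hmt : 1 - β ≤ m t := by simp only [hm]; nlinarith [ht.2]
    have hmt0 : 0 < m t := by linarith
    have hmap : ∀ x ∈ Ω, m t • x + t • b ∈ Ω := by
      intro x hx
      have := hconv hx (hΩ x hx) (sub_nonneg.2 ht.2) ht.1 (sub_add_cancel 1 t)
      convert this using 1
      simp only [hm]
      module
    have h5 := abs_integral_mul_div_le hTV
      (ρ := transportField ψ β b ∘ invAffine (m t) hmt0.ne' (t • b))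
      ((contDiff_transportField h1 β b).comp (contDiff_invAffine _ hmt0.ne' _))
      (hcs.comp_homeomorph _)
      (tsupport_comp_invAffine_subset hmt0.ne' hmap
        ((tsupport_transportField_subset ψ β b).trans h3)) hN (fun x => by
          simp only [Function.comp, transportField, norm_smul, Real.norm_eq_abs]
          by_cases hx : invAffine (m t) hmt0.ne' (t • b) x ∈ Ω
          · calc _ ≤ 1 * N := by gcongr <;> [exact h4 _; exact hNle _ hx]
              _ = N := one_mul N
          · rw [image_eq_zero_of_notMem_tsupport fun h => hx (h3 h)]
            simpa using hN.le)
    rw [setIntegral_eq_integral_of_zero hf0] at h5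
    have e : ∫ y, J' t y = -(m t ^ d)⁻¹ * ∫ y, f y *
        div (transportField ψ β b ∘ invAffine (m t) hmt0.ne' (t • b)) y := by
      rw [← integral_const_mul]
      refine integral_congr_ae (Eventually.of_forall fun y => ?_)
      simp only [hJ', hq, div_comp_invAffine _ hmt0.ne' _ (contDiff_transportField h1 β b),
        invAffine_apply, hθ]
      ring
    rw [e, norm_mul, norm_neg, Real.norm_eq_abs, Real.norm_eq_abs, mul_assoc,
      abs_of_pos (by positivity)]
    have h6 : 0 < 1 - β := by linarith
    gcongr
  have hmv := (convex_Icc (0 : ℝ) 1).norm_image_sub_le_of_norm_hasDerivWithin_le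
    (fun t ht => (hDeriv t ht).hasDerivWithinAt) hnorm
    (Set.left_mem_Icc.2 zero_le_one) (Set.right_mem_Icc.2 zero_le_one)
  have e0 : ∫ y, J 0 y = ∫ x, f x * ψ x := by simp [hJ, hm, hθ]
  have e1 : ∫ y, J 1 y = ∫ x, f (x + (b - β • x)) * ψ x := by
    have hb : 0 < 1 - β := by linarith
    have e := integral_comp_smul_add hb b (fun y => f y * ψ (invAffine (1 - β) hb.ne' b y))
    simp only [invAffine_smul_add] at e
    have e2 : ∀ x : EuclideanSpace ℝ (Fin d), x + (b - β • x) = (1 - β) • x + b := fun x => by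
      module
    simp only [e2]
    rw [e, ← integral_const_mul]
    refine integral_congr_ae (Eventually.of_forall fun y => ?_)
    simp only [hJ, hm, hθ, invAffine_apply, one_mul, one_smul]
    ring
  rw [e0, e1] at hmv
  simpa using hmv

/-- The convolution `k * F`, written as an average of the values of `F`. -/
noncomputable def mollify (k F : EuclideanSpace ℝ (Fin d) → ℝ) :
    EuclideanSpace ℝ (Fin d) → ℝ :=
  convolution F k (ContinuousLinearMap.mul ℝ ℝ) volume

lemma mollify_apply (k F : EuclideanSpace ℝ (Fin d) → ℝ) (x : EuclideanSpace ℝ (Fin d)) :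
    mollify k F x = ∫ z, F z * k (x - z) := rfl

lemma mollify_eq_integral_mul_sub (k F : EuclideanSpace ℝ (Fin d) → ℝ)
    (x : EuclideanSpace ℝ (Fin d)) : mollify k F x = ∫ z, k z * F (x - z) := by
  rw [mollify_apply, ← integral_sub_left_eq_self _ volume x]
  simp [mul_comm]

/-- Averaging does not increase the supremum norm. -/
lemma abs_mollify_le {k F : EuclideanSpace ℝ (Fin d) → ℝ} {M : ℝ} (hk : ∀ x, 0 ≤ k x)
    (hki : Integrable k) (hk1 : ∫ x, k x = 1) (hF : ∀ x, |F x| ≤ M)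
    (x : EuclideanSpace ℝ (Fin d)) : |mollify k F x| ≤ M := by
  have h := norm_integral_le_of_norm_le (hki.mul_const M) (f := fun t => k t * F (x - t))
    (Eventually.of_forall fun t => by
      rw [norm_mul, Real.norm_of_nonneg (hk t)]
      exact mul_le_mul_of_nonneg_left (hF _) (hk t))
  rwa [integral_mul_const, hk1, one_mul, ← mollify_eq_integral_mul_sub] at h

lemma contDiff_mollify {k F : EuclideanSpace ℝ (Fin d) → ℝ} (hk : ContDiff ℝ 1 k)
    (hkc : HasCompactSupport k) (hF : LocallyIntegrable F) : ContDiff ℝ 1 (mollify k F) :=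
  hkc.contDiff_convolution_right (n := 1) _ hF hk

/-- The `L¹` norm on a compact set is recovered by testing against mollifications of the sign. -/
lemma setIntegral_abs_le_of_isCompact (hΩ : IsOpen Ω) {g : EuclideanSpace ℝ (Fin d) → ℝ}
    (hgm : Measurable g) (hg : Integrable g) {B : ℝ}
    (h : ∀ ψ : EuclideanSpace ℝ (Fin d) → ℝ, ContDiff ℝ 1 ψ → HasCompactSupport ψ →
      tsupport ψ ⊆ Ω → (∀ x, |ψ x| ≤ 1) → |∫ x, g x * ψ x| ≤ B)
    {K : Set (EuclideanSpace ℝ (Fin d))} (hK : IsCompact K) (hKΩ : K ⊆ Ω) :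
    ∫ x in K, |g x| ≤ B := by
  obtain ⟨δ, hδ, hδK⟩ := hK.exists_cthickening_subset_open hΩ hKΩ
  -- the sign of `g` on `K`; the value `0 / 0 = 0` at the zeros of `g` is harmless
  set s : EuclideanSpace ℝ (Fin d) → ℝ := K.indicator (fun x => g x / |g x|) with hs
  have hsm : Measurable s := (hgm.div hgm.abs).indicator hK.measurableSet
  have hs1 : ∀ x, |s x| ≤ 1 := by
    intro x
    by_cases hx : x ∈ K
    · rw [hs, Set.indicator_of_mem hx, abs_div, abs_abs]
      exact div_self_le_one _
    · simp [hs, hx]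
  have hsloc : LocallyIntegrable s :=
    (memLp_top_of_bound hsm.aestronglyMeasurable 1 (Eventually.of_forall hs1)).locallyIntegrable
      le_top
  let φ : ℕ → ContDiffBump (0 : EuclideanSpace ℝ (Fin d)) := fun n =>
    ⟨δ / (n + 1) / 2, δ / (n + 1), by positivity, half_lt_self (by positivity)⟩
  have hφ : Tendsto (fun n => (φ n).rOut) atTop (𝓝 0) := by
    have := (tendsto_one_div_add_atTop_nhds_zero_nat (𝕜 := ℝ)).const_mul δ
    simpa [φ, div_eq_mul_inv] using this
  have hconv := ContDiffBump.ae_convolution_tendsto_right_of_locallyIntegrable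
    (μ := (volume : Measure (EuclideanSpace ℝ (Fin d)))) (K := 2) hφ
    (Eventually.of_forall fun n => le_of_eq (by simp only [φ]; ring)) hsloc
  set ψ : ℕ → EuclideanSpace ℝ (Fin d) → ℝ := fun n =>
    mollify ((φ n).normed volume) s with hψ
  have hψC : ∀ n, ContDiff ℝ 1 (ψ n) := fun n =>
    contDiff_mollify (φ n).contDiff_normed (φ n).hasCompactSupport_normed hsloc
  have hψ1 : ∀ n x, |ψ n x| ≤ 1 := by
    intro n x
    exact abs_mollify_le (φ n).nonneg_normed (φ n).integrable_normed
      ((φ n).integral_normed) hs1 x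
  have hψs : ∀ n, tsupport (ψ n) ⊆ Metric.cthickening δ K := by
    intro n
    refine closure_minimal ?_ Metric.isClosed_cthickening
    refine (support_convolution_subset _).trans ?_
    rw [(φ n).support_normed_eq]
    rintro _ ⟨v, hv, u, hu, rfl⟩
    have hv' : v ∈ K := by
      by_contra hv'
      simp [hs, hv'] at hv
    refine Metric.mem_cthickening_of_dist_le _ v δ K hv' ?_
    have hu' : ‖u‖ < δ / (n + 1) := by simpa using hu
    rw [dist_eq_norm, add_sub_cancel_left]
    refine hu'.le.trans (div_le_self hδ.le ?_)
    linarith [(Nat.cast_nonneg n : (0 : ℝ) ≤ n)]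
  have hlim : Tendsto (fun n => ∫ x, g x * ψ n x) atTop (𝓝 (∫ x, g x * s x)) := by
    refine tendsto_integral_of_dominated_convergence (fun x => |g x|) ?_ hg.abs ?_ ?_
    · exact fun n => hg.1.mul (hψC n).continuous.aestronglyMeasurable
    · refine fun n => Eventually.of_forall fun x => ?_
      rw [norm_mul]
      exact mul_le_of_le_one_right (abs_nonneg _) (hψ1 n x)
    · filter_upwards [hconv] with x hx
      refine (hx.congr fun n => ?_).const_mul _
      exact (mollify_eq_integral_mul_sub _ _ _).symm
  have heq : ∫ x, g x * s x = ∫ x in K, |g x| := by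
    rw [← integral_indicator hK.measurableSet]
    refine integral_congr_ae (Eventually.of_forall fun x => ?_)
    by_cases hx : x ∈ K
    · simp only [hs, Set.indicator_of_mem hx]
      rcases eq_or_ne (g x) 0 with h0 | h0
      · simp [h0]
      · rw [← mul_div_assoc, ← abs_mul_abs_self (g x), mul_div_assoc, div_self (abs_ne_zero.2 h0),
          mul_one]
    · simp [hs, hx]
  rw [← heq]
  refine le_of_tendsto' hlim fun n => (le_abs_self _).trans (h _ (hψC n) ?_ ?_ (hψ1 n))
  · exact hK.cthickening.of_isClosed_subset (isClosed_tsupport _) (hψs n)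
  · exact (hψs n).trans hδK

/-- Duality: the `L¹` norm on an open set is a supremum over compactly supported `C¹` functions. -/
lemma setIntegral_abs_le_of_forall_test (hΩ : IsOpen Ω) (hb : Bornology.IsBounded Ω)
    {g : EuclideanSpace ℝ (Fin d) → ℝ} (hgm : Measurable g) (hg : Integrable g) {B : ℝ}
    (h : ∀ ψ : EuclideanSpace ℝ (Fin d) → ℝ, ContDiff ℝ 1 ψ → HasCompactSupport ψ →
      tsupport ψ ⊆ Ω → (∀ x, |ψ x| ≤ 1) → |∫ x, g x * ψ x| ≤ B) :
    ∫ x in Ω, |g x| ≤ B := by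
  obtain ⟨F, hFc, hFs, hFU, hFm⟩ := hΩ.exists_iUnion_isClosed
  have := tendsto_setIntegral_of_monotone (μ := volume) (f := fun x => |g x|)
    (fun n => (hFc n).measurableSet) hFm hg.abs.integrableOn
  rw [hFU] at this
  exact le_of_tendsto' this fun n => setIntegral_abs_le_of_isCompact hΩ hgm hg h
    (Metric.isCompact_of_isClosed_isBounded (hFc n) (hb.subset (hFs n))) (hFs n)

/-- A bounded function of bounded variation on a bounded convex open set, represented by a
measurable function which is bounded by `M` everywhere and vanishes outside of the domain. -/
structure IsBoundedBV (Ω : Set (EuclideanSpace ℝ (Fin d))) (f : EuclideanSpace ℝ (Fin d) → ℝ)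
    (M : ℝ) : Prop where
  isOpen : IsOpen Ω
  isBounded : Bornology.IsBounded Ω
  convex : Convex ℝ Ω
  measurable : Measurable f
  abs_le : ∀ x, |f x| ≤ M
  zero : ∀ x ∉ Ω, f x = 0
  TV_ne_top : TV Ω f ≠ ∞

namespace IsBoundedBV

variable {f : EuclideanSpace ℝ (Fin d) → ℝ} {M : ℝ}

lemma integrable (hf : IsBoundedBV Ω f M) : Integrable f := by
  have h1 : IntegrableOn f Ω := by
    refine Measure.integrableOn_of_bounded hf.isBounded.measure_lt_top.ne
      hf.measurable.aestronglyMeasurable (M := M) ?_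
    exact Eventually.of_forall hf.abs_le
  rw [← integrableOn_univ]
  exact h1.of_forall_sdiff_eq_zero MeasurableSet.univ fun x hx => hf.zero x hx.2

lemma nonneg (hf : IsBoundedBV Ω f M) : 0 ≤ M := (abs_nonneg _).trans (hf.abs_le 0)

/-- A contraction of the domain into itself which moves no point by more than `N` moves the
function by at most a multiple of `N * TV Ω f` in `L¹`. -/
lemma setIntegral_abs_comp_sub_le (hf : IsBoundedBV Ω f M) {β : ℝ} (hβ0 : 0 ≤ β)
    (hβ1 : β ≤ 1 / 4) {b : EuclideanSpace ℝ (Fin d)} (hΩ : ∀ x ∈ Ω, x + (b - β • x) ∈ Ω)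
    {N : ℝ} (hN : 0 < N) (hNle : ∀ x ∈ Ω, ‖b - β • x‖ ≤ N) :
    ∫ x in Ω, |f (x + (b - β • x)) - f x| ≤ ((1 - β) ^ d)⁻¹ * N * (TV Ω f).toReal := by
  have hβ : (1 - β) ≠ 0 := by linarith
  have hcomp : Integrable fun x => f (x + (b - β • x)) := by
    have e : (fun x => f (x + (b - β • x))) = fun x => f ((1 - β) • x + b) := by
      ext x
      congr 1
      module
    rw [e]
    exact (hf.integrable.comp_add_right b).comp_smul hβ
  have hm : Measurable fun x => f (x + (b - β • x)) := hf.measurable.comp (by fun_prop)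
  refine setIntegral_abs_le_of_forall_test hf.isOpen hf.isBounded (hm.sub hf.measurable)
    (hcomp.sub hf.integrable) fun ψ h1 h2 h3 h4 => ?_
  have h5 := abs_integral_comp_sub_mul_le hf.integrable hf.zero hf.TV_ne_top hf.convex hβ0 hβ1 hΩ
    hN hNle h1 h2 h3 h4
  have hb : ∀ᵐ x, ‖ψ x‖ ≤ 1 := Eventually.of_forall h4
  have h6 := h1.continuous.aestronglyMeasurable (μ := (volume : Measure (EuclideanSpace ℝ (Fin d))))
  rw [← integral_sub (hcomp.mul_bdd h6 hb) (hf.integrable.mul_bdd h6 hb)] at h5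
  simpa only [sub_mul, Pi.sub_apply] using h5

end IsBoundedBV

/-- The function `f` dilated from the point `x₀` by the factor `(1 - β)⁻¹`. -/
def dilate (f : EuclideanSpace ℝ (Fin d) → ℝ) (x₀ : EuclideanSpace ℝ (Fin d)) (β : ℝ)
    (z : EuclideanSpace ℝ (Fin d)) : ℝ :=
  f ((1 - β) • z + β • x₀)

/-- The local oscillation of `f`: the `L¹` distance, on the ball of radius `R` around `x`, of the
dilation of `f` to the constant `f x`. -/
noncomputable def oscillation (f : EuclideanSpace ℝ (Fin d) → ℝ) (x₀ : EuclideanSpace ℝ (Fin d))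
    (β R : ℝ) (x : EuclideanSpace ℝ (Fin d)) : ℝ :=
  ∫ w in Metric.ball 0 R, |dilate f x₀ β (x + w) - f x|

lemma oscillation_nonneg (f : EuclideanSpace ℝ (Fin d) → ℝ) (x₀ : EuclideanSpace ℝ (Fin d))
    (β R : ℝ) (x : EuclideanSpace ℝ (Fin d)) : 0 ≤ oscillation f x₀ β R x :=
  integral_nonneg fun _ => abs_nonneg _

namespace IsBoundedBV

variable {f : EuclideanSpace ℝ (Fin d) → ℝ} {M : ℝ}

lemma measurable_dilate (hf : IsBoundedBV Ω f M) (x₀ : EuclideanSpace ℝ (Fin d)) (β : ℝ) :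
    Measurable (dilate f x₀ β) :=
  hf.measurable.comp (by fun_prop)

lemma integrable_dilate (hf : IsBoundedBV Ω f M) (x₀ : EuclideanSpace ℝ (Fin d)) {β : ℝ}
    (hβ : β < 1) : Integrable (dilate f x₀ β) :=
  (hf.integrable.comp_add_right (β • x₀)).comp_smul (sub_pos.2 hβ).ne'

lemma integrable_oscillation_integrand (hf : IsBoundedBV Ω f M) (x₀ : EuclideanSpace ℝ (Fin d))
    (β R : ℝ) : Integrable
      (fun p : EuclideanSpace ℝ (Fin d) × EuclideanSpace ℝ (Fin d) =>
        |dilate f x₀ β (p.1 + p.2) - f p.1|)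
      ((volume.restrict Ω).prod (volume.restrict (Metric.ball 0 R))) := by
  have : IsFiniteMeasure (volume.restrict Ω) := ⟨by simpa using hf.isBounded.measure_lt_top⟩
  have : IsFiniteMeasure (volume.restrict (Metric.ball (0 : EuclideanSpace ℝ (Fin d)) R)) :=
    ⟨by simpa using measure_ball_lt_top⟩
  have hm : Measurable (fun p : EuclideanSpace ℝ (Fin d) × EuclideanSpace ℝ (Fin d) =>
      |dilate f x₀ β (p.1 + p.2) - f p.1|) :=
    (((hf.measurable_dilate x₀ β).comp (measurable_fst.add measurable_snd)).sub
      (hf.measurable.comp measurable_fst)).abs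
  refine Integrable.of_bound hm.aestronglyMeasurable (M + M) (Eventually.of_forall fun p => ?_)
  rw [Real.norm_eq_abs, abs_abs]
  exact (abs_sub _ _).trans (add_le_add (hf.abs_le _) (hf.abs_le _))

lemma integrableOn_oscillation (hf : IsBoundedBV Ω f M) (x₀ : EuclideanSpace ℝ (Fin d))
    (β R : ℝ) : IntegrableOn (oscillation f x₀ β R) Ω :=
  (hf.integrable_oscillation_integrand x₀ β R).integral_prod_left

/-- The dilation compensates displacements: `Ω` is mapped into itself if it is first translated by
a vector of length less than `2 * ε` and then contracted towards `x₀` by the factor `1 - β`. -/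
lemma smul_add_mem (hf : IsBoundedBV Ω f M) {x₀ : EuclideanSpace ℝ (Fin d)}
    {r β ε : ℝ} (hr : 0 < r) (hrΩ : Metric.ball x₀ r ⊆ Ω) (hε : 0 < ε) (hβ : β = 4 * ε / r)
    (hβ1 : β ≤ 1 / 4) {w x : EuclideanSpace ℝ (Fin d)} (hw : ‖w‖ < 2 * ε) (hx : x ∈ Ω) :
    (1 - β) • (x + w) + β • x₀ ∈ Ω := by
  have hβ0 : 0 < β := by rw [hβ]; positivity
  -- the image is the convex combination `(1 - β) • x + β • (x₀ + (β⁻¹ * (1 - β)) • w)`, and the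
  -- choice of `β` keeps the second point within the ball of radius `r / 2` around `x₀`
  have h1 : x₀ + (β⁻¹ * (1 - β)) • w ∈ Ω := by
    apply hrΩ
    rw [mem_ball_iff_norm, add_sub_cancel_left, norm_smul, Real.norm_of_nonneg
      (by have : 0 ≤ 1 - β := by linarith
          positivity)]
    calc β⁻¹ * (1 - β) * ‖w‖ ≤ β⁻¹ * 1 * (2 * ε) := by gcongr; linarith
      _ = r / 2 := by rw [hβ]; field_simp; norm_num
      _ < r := half_lt_self hr
  have := hf.convex hx h1 (by linarith : 0 ≤ 1 - β) hβ0.le (sub_add_cancel 1 β)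
  convert this using 1
  rw [smul_add, smul_add, smul_smul, ← mul_assoc, mul_inv_cancel₀ hβ0.ne', one_mul]
  module

/-- The oscillation is integrated by exchanging the two integrals: for a fixed displacement `w` the
map `x ↦ (1 - β) • (x + w) + β • x₀` is a contraction of the domain. -/
lemma setIntegral_oscillation_le (hf : IsBoundedBV Ω f M) {x₀ : EuclideanSpace ℝ (Fin d)}
    {r R β ε : ℝ} (hr : 0 < r) (hR : 0 < R) (hrΩ : Metric.ball x₀ r ⊆ Ω)
    (hRΩ : Ω ⊆ Metric.closedBall x₀ R) (hε : 0 < ε) (hβ : β = 4 * ε / r) (hβ1 : β ≤ 1 / 4) :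
    ∫ x in Ω, oscillation f x₀ β (2 * ε) x ≤
      (2 ^ d * 2 ^ d * (4 * R / r + 2) *
        (volume (Metric.ball (0 : EuclideanSpace ℝ (Fin d)) 1)).toReal * (TV Ω f).toReal)
        * ε ^ (d + 1) := by
  have hβ0 : 0 < β := by rw [hβ]; positivity
  have hN : 0 < β * R + 2 * ε := by positivity
  set B : ℝ := ((1 - β) ^ d)⁻¹ * (β * R + 2 * ε) * (TV Ω f).toReal with hB
  have key : ∀ w ∈ Metric.ball (0 : EuclideanSpace ℝ (Fin d)) (2 * ε),
      ∫ x in Ω, |dilate f x₀ β (x + w) - f x| ≤ B := by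
    intro w hw
    rw [mem_ball_zero_iff] at hw
    have e : ∀ x : EuclideanSpace ℝ (Fin d),
        (1 - β) • (x + w) + β • x₀ = x + ((β • x₀ + (1 - β) • w) - β • x) := fun x => by module
    simp only [dilate, e]
    refine hf.setIntegral_abs_comp_sub_le hβ0.le hβ1 (fun x hx => ?_) hN fun x hx => ?_
    · rw [← e]
      exact hf.smul_add_mem hr hrΩ hε hβ hβ1 hw hx
    · have h1 : β • x₀ + (1 - β) • w - β • x = (1 - β) • w - β • (x - x₀) := by module
      have h2 : ‖x - x₀‖ ≤ R := by simpa [dist_eq_norm] using hRΩ hx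
      rw [h1]
      calc _ ≤ ‖(1 - β) • w‖ + ‖β • (x - x₀)‖ := norm_sub_le _ _
        _ = (1 - β) * ‖w‖ + β * ‖x - x₀‖ := by
          rw [norm_smul, norm_smul, Real.norm_of_nonneg hβ0.le,
            Real.norm_of_nonneg (by linarith : 0 ≤ 1 - β)]
        _ ≤ 1 * (2 * ε) + β * R := by gcongr; linarith
        _ = _ := by ring
  have hB0 : 0 ≤ B := by
    have : 0 < 1 - β := by linarith
    positivity
  have hint := hf.integrable_oscillation_integrand x₀ β (2 * ε)
  unfold oscillation
  rw [integral_integral_swap hint]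
  calc ∫ w in Metric.ball 0 (2 * ε), ∫ x in Ω, |dilate f x₀ β (x + w) - f x|
      ≤ ∫ w in Metric.ball (0 : EuclideanSpace ℝ (Fin d)) (2 * ε), B :=
        setIntegral_mono_on hint.integral_prod_right
          (integrableOn_const measure_ball_lt_top.ne) measurableSet_ball key
    _ = (2 * ε) ^ d * (volume (Metric.ball (0 : EuclideanSpace ℝ (Fin d)) 1)).toReal * B := by
        rw [setIntegral_const, smul_eq_mul, Measure.real,
          Measure.addHaar_ball_of_pos _ _ (by positivity : 0 < 2 * ε), ENNReal.toReal_mul,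
          ENNReal.toReal_ofReal (by positivity)]
        simp
    _ ≤ (2 * ε) ^ d * (volume (Metric.ball (0 : EuclideanSpace ℝ (Fin d)) 1)).toReal *
          (2 ^ d * (β * R + 2 * ε) * (TV Ω f).toReal) := by
        rw [hB]
        have h1 : 0 < 1 - β := by linarith
        have h2 : (1 - β)⁻¹ ≤ 2 := by rw [inv_le_comm₀ h1 two_pos]; linarith
        rw [← inv_pow]
        gcongr
    _ = _ := by
        rw [hβ]
        field_simp
        ring

end IsBoundedBV

/-! ### Mollification at scale `ε` -/

/-- A mollification kernel at scale `ε`: a `C¹` probability density supported in the ball of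
radius `ε`, with bounds on its size and on the Lipschitz constant of its derivative which scale in
`ε` as they do for the rescalings of one fixed kernel. -/
structure IsKernel (k : EuclideanSpace ℝ (Fin d) → ℝ) (ε C : ℝ) : Prop where
  contDiff : ContDiff ℝ 1 k
  nonneg : ∀ z, 0 ≤ k z
  zero : ∀ z, ε ≤ ‖z‖ → k z = 0
  integral : ∫ z, k z = 1
  le : ∀ z, k z ≤ C * (ε ^ d)⁻¹
  lipschitz : ∀ y z, ‖fderiv ℝ k y - fderiv ℝ k z‖ ≤ C * (ε ^ (d + 2))⁻¹ * ‖y - z‖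

lemma exists_isKernel (d : ℕ) : ∃ C : ℝ, 0 < C ∧ ∀ ε : ℝ, 0 < ε →
    ∃ k : EuclideanSpace ℝ (Fin d) → ℝ, IsKernel k ε C := by
  let φ : ContDiffBump (0 : EuclideanSpace ℝ (Fin d)) := ⟨1 / 2, 1, by norm_num, by norm_num⟩
  set η := φ.normed volume with hη
  have hηc : HasCompactSupport η := φ.hasCompactSupport_normed
  have hη2 : ContDiff ℝ 2 η := φ.contDiff_normed
  obtain ⟨C₁, hC₁⟩ := hηc.exists_bound_of_continuous hη2.continuous
  obtain ⟨C₂, hC₂⟩ := (hη2.fderiv_right (m := 1) (by norm_num)).lipschitzWith_of_hasCompactSupport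
    (hηc.fderiv ℝ) one_ne_zero
  refine ⟨|C₁| + C₂ + 1, by positivity, fun ε hε => ?_⟩
  have hd : ∀ z, HasFDerivAt (fun z => (ε ^ d)⁻¹ * η (ε⁻¹ • z))
      (((ε ^ d)⁻¹ * ε⁻¹) • fderiv ℝ η (ε⁻¹ • z)) z := by
    intro z
    have h1 : HasFDerivAt (fun z : EuclideanSpace ℝ (Fin d) => ε⁻¹ • z)
        (ε⁻¹ • ContinuousLinearMap.id ℝ (EuclideanSpace ℝ (Fin d))) z :=
      (hasFDerivAt_id z).const_smul ε⁻¹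
    have h2 := ((hη2.differentiable two_ne_zero (ε⁻¹ • z)).hasFDerivAt.comp z h1).const_mul
      (ε ^ d)⁻¹
    refine h2.congr_fderiv ?_
    ext v
    simp [mul_assoc]
  refine ⟨fun z => (ε ^ d)⁻¹ * η (ε⁻¹ • z), ?_, fun z => ?_, fun z hz => ?_, ?_, fun z => ?_,
    fun y z => ?_⟩
  · have h1 : ContDiff ℝ 1 η := hη2.of_le (by norm_num)
    fun_prop
  · exact mul_nonneg (by positivity) (φ.nonneg_normed _)
  · have : ε⁻¹ • z ∉ Function.support η := by
      rw [hη, φ.support_normed_eq, mem_ball_zero_iff, norm_smul,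
        Real.norm_of_nonneg (by positivity), not_lt]
      change 1 ≤ _
      rwa [← div_eq_inv_mul, one_le_div hε]
    rw [Function.notMem_support.1 this, mul_zero]
  · rw [integral_const_mul, Measure.integral_comp_inv_smul_of_nonneg _ _ hε.le]
    rw [hη, φ.integral_normed]
    simp only [finrank_euclideanSpace, Fintype.card_fin, smul_eq_mul, mul_one]
    exact inv_mul_cancel₀ (by positivity)
  · rw [mul_comm]
    gcongr
    calc η (ε⁻¹ • z) ≤ C₁ := (le_abs_self _).trans (hC₁ _)
      _ ≤ |C₁| + C₂ + 1 := by
        have := le_abs_self C₁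
        have := C₂.2
        linarith
  · rw [(hd y).fderiv, (hd z).fderiv, ← smul_sub, norm_smul, Real.norm_of_nonneg (by positivity)]
    calc (ε ^ d)⁻¹ * ε⁻¹ * ‖fderiv ℝ η (ε⁻¹ • y) - fderiv ℝ η (ε⁻¹ • z)‖
        ≤ (ε ^ d)⁻¹ * ε⁻¹ * (C₂ * ‖ε⁻¹ • y - ε⁻¹ • z‖) := by
          gcongr
          exact hC₂.norm_sub_le _ _
      _ = C₂ * (ε ^ (d + 2))⁻¹ * ‖y - z‖ := by
          rw [← smul_sub, norm_smul, Real.norm_of_nonneg (by positivity), pow_add]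
          field_simp
      _ ≤ _ := by
          gcongr
          have := abs_nonneg C₁
          linarith

namespace IsKernel

variable {k F : EuclideanSpace ℝ (Fin d) → ℝ} {ε C : ℝ}

lemma hasCompactSupport (hk : IsKernel k ε C) : HasCompactSupport k :=
  HasCompactSupport.intro (isCompact_closedBall 0 ε) fun x hx =>
    hk.zero x (by simpa using le_of_lt (by simpa using hx))

lemma integrable (hk : IsKernel k ε C) : Integrable k :=
  hk.contDiff.continuous.integrable_of_hasCompactSupport hk.hasCompactSupport

lemma fderiv_eq_zero (hk : IsKernel k ε C) {z : EuclideanSpace ℝ (Fin d)} (hz : ε < ‖z‖) :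
    fderiv ℝ k z = 0 := by
  have : k =ᶠ[𝓝 z] fun _ => 0 := by
    filter_upwards [continuous_norm.continuousAt.eventually (lt_mem_nhds hz)] with y hy
    exact hk.zero y hy.le
  rw [this.fderiv_eq]
  simp

lemma fderiv_mollify_apply (hk : IsKernel k ε C) (hF : LocallyIntegrable F)
    (y v : EuclideanSpace ℝ (Fin d)) :
    fderiv ℝ (mollify k F) y v = ∫ z, F z * fderiv ℝ k (y - z) v := by
  have h := hk.hasCompactSupport.hasFDerivAt_convolution_right (ContinuousLinearMap.mul ℝ ℝ)
    hF hk.contDiff y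
  rw [mollify, h.fderiv, convolution_precompR_apply _ hF (hk.hasCompactSupport.fderiv ℝ)
    (hk.contDiff.continuous_fderiv one_ne_zero)]
  rfl

lemma integral_fderiv_apply (hk : IsKernel k ε C) (v : EuclideanSpace ℝ (Fin d)) :
    ∫ z, fderiv ℝ k z v = 0 := by
  obtain ⟨D, hD⟩ := hk.contDiff.lipschitzWith_of_hasCompactSupport hk.hasCompactSupport one_ne_zero
  have h := LipschitzWith.integral_lineDeriv_mul_eq
    (μ := (volume : Measure (EuclideanSpace ℝ (Fin d))))
    (LipschitzWith.const (1 : ℝ) : LipschitzWith 0 fun _ : EuclideanSpace ℝ (Fin d) => (1 : ℝ))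
    hD hk.hasCompactSupport (-v)
  have h0 : ∀ x, lineDeriv ℝ (fun _ : EuclideanSpace ℝ (Fin d) => (1 : ℝ)) x (-v) = 0 := fun x => by
    simp [lineDeriv]
  simp only [h0, zero_mul, integral_zero, mul_one, neg_neg] at h
  rw [h]
  refine integral_congr_ae (Eventually.of_forall fun z => ?_)
  exact (hk.contDiff.differentiable one_ne_zero z).lineDeriv_eq_fderiv.symm

lemma exists_lipschitzWith_mollify (hk : IsKernel k ε C) (hF : Integrable F) :
    ∃ D, LipschitzWith D (mollify k F) := by
  obtain ⟨D, hD⟩ := hk.contDiff.lipschitzWith_of_hasCompactSupport hk.hasCompactSupport one_ne_zero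
  have hb := hk.hasCompactSupport.exists_bound_of_continuous hk.contDiff.continuous
  obtain ⟨B, hB⟩ := hb
  have hi : ∀ y, Integrable fun z => F z * k (y - z) := fun y =>
    hF.mul_bdd
      (hk.contDiff.continuous.comp (continuous_const.sub continuous_id)).aestronglyMeasurable
      (Eventually.of_forall fun z => hB (y - z))
  refine ⟨(∫ z, |F z|).toNNReal * D, LipschitzWith.of_dist_le_mul fun x y => ?_⟩
  rw [Real.dist_eq, mollify_apply, mollify_apply, ← integral_sub (hi x) (hi y),
    ← Real.norm_eq_abs]
  refine (norm_integral_le_of_norm_le (hF.abs.mul_const (D * dist x y))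
    (Eventually.of_forall fun z => ?_)).trans_eq ?_
  · rw [← mul_sub, norm_mul]
    have := hD.dist_le_mul (x - z) (y - z)
    rw [dist_sub_right] at this
    exact mul_le_mul_of_nonneg_left this (abs_nonneg _)
  · rw [integral_mul_const]
    rw [NNReal.coe_mul, Real.coe_toNNReal _ (integral_nonneg fun _ => abs_nonneg _), mul_assoc]

end IsKernel

/-- Integrals against a kernel supported in the ball of radius `R` around `x`. -/
lemma abs_integral_mul_le_of_support {F κ : EuclideanSpace ℝ (Fin d) → ℝ} {a D R : ℝ}
    {x : EuclideanSpace ℝ (Fin d)} (hF : LocallyIntegrable F)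
    (hκD : ∀ z, |κ z| ≤ D) (hκ0 : ∀ z ∉ Metric.ball x R, κ z = 0) :
    |∫ z, (F z - a) * κ z| ≤ D * ∫ w in Metric.ball 0 R, |F (x + w) - a| := by
  have h1 : ∫ w in Metric.ball 0 R, |F (x + w) - a| = ∫ z in Metric.ball x R, |F z - a| := by
    rw [← integral_indicator measurableSet_ball, ← integral_indicator measurableSet_ball,
      ← integral_add_left_eq_self ((Metric.ball x R).indicator fun z => |F z - a|) x]
    refine integral_congr_ae (Eventually.of_forall fun w => ?_)
    by_cases hw : w ∈ Metric.ball (0 : EuclideanSpace ℝ (Fin d)) R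
    · have : x + w ∈ Metric.ball x R := by simpa using hw
      simp only [Set.indicator_of_mem hw, Set.indicator_of_mem this]
    · have : x + w ∉ Metric.ball x R := by simpa using hw
      simp only [Set.indicator_of_notMem hw, Set.indicator_of_notMem this]
  have h2 : IntegrableOn (fun z => |F z - a|) (Metric.ball x R) := by
    have h3 : IntegrableOn F (Metric.ball x R) :=
      (hF.integrableOn_isCompact (isCompact_closedBall x R)).mono_set Metric.ball_subset_closedBall
    exact (h3.sub (integrableOn_const measure_ball_lt_top.ne)).abs
  rw [h1, ← integral_const_mul, ← integral_indicator measurableSet_ball]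
  have h3 := IntegrableOn.integrable_indicator (h2.const_mul D) measurableSet_ball
  rw [← Real.norm_eq_abs]
  refine norm_integral_le_of_norm_le h3
    (Eventually.of_forall fun z => ?_)
  by_cases hz : z ∈ Metric.ball x R
  · rw [Set.indicator_of_mem hz, norm_mul, mul_comm]
    exact mul_le_mul_of_nonneg_right (hκD z) (abs_nonneg _)
  · simp [hκ0 z hz, hz]

namespace IsKernel

variable {k F : EuclideanSpace ℝ (Fin d) → ℝ} {ε C : ℝ}

/-- Near `x`, the mollification differs from any constant `a` by a local `L¹` norm of `F - a`. -/
lemma abs_mollify_sub_le (hk : IsKernel k ε C) (hF : LocallyIntegrable F)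
    {x y : EuclideanSpace ℝ (Fin d)} (hxy : ‖y - x‖ ≤ ε) (a : ℝ) :
    |mollify k F y - a| ≤ C * (ε ^ d)⁻¹ * ∫ w in Metric.ball 0 (2 * ε), |F (x + w) - a| := by
  have hkc : Continuous fun z => k (y - z) := hk.contDiff.continuous.comp (by fun_prop)
  have h1 : HasCompactSupport fun z => k (y - z) :=
    hk.hasCompactSupport.comp_homeomorph (Homeomorph.subLeft y)
  have h2 : ∫ z, a * k (y - z) = a := by
    rw [integral_const_mul, integral_sub_left_eq_self, hk.integral, mul_one]
  have h3 : mollify k F y - a = ∫ z, (F z - a) * k (y - z) := by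
    conv_lhs => rw [← h2]
    have h4 : Integrable fun z => F z * k (y - z) :=
      hF.integrable_smul_right_of_hasCompactSupport hkc h1
    rw [mollify_apply, ← integral_sub h4 ((hkc.integrable_of_hasCompactSupport h1).const_mul a)]
    simp only [sub_mul]
  rw [h3]
  refine abs_integral_mul_le_of_support hF (fun z => ?_) fun z hz => hk.zero _ ?_
  · rw [abs_of_nonneg (hk.nonneg _)]
    exact hk.le _
  · rw [mem_ball_iff_norm, not_lt] at hz
    have h5 : ‖z - x‖ ≤ ‖y - x‖ + ‖y - z‖ := by
      rw [show z - x = (y - x) - (y - z) by abel]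
      exact norm_sub_le _ _
    linarith

/-- Near `x`, the derivative of the mollification is Lipschitz, with a constant controlled by a
local `L¹` norm of `F - a`, for any constant `a`. -/
lemma norm_fderiv_mollify_sub_le (hk : IsKernel k ε C) (hC : 0 ≤ C) (hε : 0 < ε)
    (hF : LocallyIntegrable F)
    {x y y' : EuclideanSpace ℝ (Fin d)} (hxy : ‖y - x‖ < ε) (hxy' : ‖y' - x‖ < ε) (a : ℝ) :
    ‖fderiv ℝ (mollify k F) y - fderiv ℝ (mollify k F) y'‖ ≤
      C * (ε ^ (d + 2))⁻¹ * (∫ w in Metric.ball 0 (2 * ε), |F (x + w) - a|) * ‖y - y'‖ := by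
  have hA : 0 ≤ ∫ w in Metric.ball 0 (2 * ε), |F (x + w) - a| :=
    integral_nonneg fun _ => abs_nonneg _
  refine ContinuousLinearMap.opNorm_le_bound _ (by positivity) fun v => ?_
  set κ : EuclideanSpace ℝ (Fin d) → EuclideanSpace ℝ (Fin d) → ℝ :=
    fun y z => fderiv ℝ k (y - z) v with hκ
  have hfc := hk.contDiff.continuous_fderiv one_ne_zero
  have hκc : ∀ y, Continuous (κ y) := fun y => by simp only [hκ]; fun_prop
  have hκs : ∀ y, HasCompactSupport (κ y) := fun y =>
    ((hk.hasCompactSupport.fderiv_apply ℝ v).comp_homeomorph (Homeomorph.subLeft y))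
  have hκ0 : ∀ y, ∫ z, κ y z = 0 := fun y => by
    simp only [hκ]
    rw [integral_sub_left_eq_self (fun z => fderiv ℝ k z v)]
    exact hk.integral_fderiv_apply v
  have hi : ∀ y, Integrable fun z => F z * κ y z := fun y =>
    hF.integrable_smul_right_of_hasCompactSupport (hκc y) (hκs y)
  have hiκ : ∀ y, Integrable (κ y) := fun y =>
    (hκc y).integrable_of_hasCompactSupport (hκs y)
  have h3 : (fderiv ℝ (mollify k F) y - fderiv ℝ (mollify k F) y') v
      = ∫ z, (F z - a) * (κ y z - κ y' z) := by
    have e : ∀ z, (F z - a) * (κ y z - κ y' z)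
        = (F z * κ y z - F z * κ y' z) - a * (κ y z - κ y' z) := fun z => by ring
    simp only [e]
    have e1 := integral_sub (f := fun z => F z * κ y z - F z * κ y' z)
      (g := fun z => a * (κ y z - κ y' z))
      ((hi y).sub (hi y')) (((hiκ y).sub (hiκ y')).const_mul a)
    rw [e1, integral_sub (hi y) (hi y'), integral_const_mul, integral_sub (hiκ y) (hiκ y'),
      hκ0, hκ0,
      sub_apply, hk.fderiv_mollify_apply hF, hk.fderiv_mollify_apply hF]
    simp [hκ]
  rw [h3]
  refine (abs_integral_mul_le_of_support (x := x) (R := 2 * ε)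
    (D := C * (ε ^ (d + 2))⁻¹ * ‖y - y'‖ * ‖v‖) hF (fun z => ?_) fun z hz => ?_).trans_eq (by ring)
  · have := (fderiv ℝ k (y - z) - fderiv ℝ k (y' - z)).le_of_opNorm_le (hk.lipschitz _ _) v
    rwa [sub_sub_sub_cancel_right] at this
  · rw [mem_ball_iff_norm, not_lt] at hz
    have h5 : ∀ y, ‖y - x‖ < ε → ε < ‖y - z‖ := fun y hy => by
      have : ‖z - x‖ ≤ ‖y - x‖ + ‖y - z‖ := by
        rw [show z - x = (y - x) - (y - z) by abel]
        exact norm_sub_le _ _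
      linarith
    simp [hκ, hk.fderiv_eq_zero (h5 y hxy), hk.fderiv_eq_zero (h5 y' hxy')]

end IsKernel

namespace IsBoundedBV

variable {f k : EuclideanSpace ℝ (Fin d) → ℝ} {M C : ℝ}

/-- The mollification of the dilation is an average of pull-backs of `f` along contractions of the
domain, so that its total variation is almost bounded by that of `f`. -/
lemma integral_mollify_mul_div_le (hf : IsBoundedBV Ω f M) {x₀ : EuclideanSpace ℝ (Fin d)}
    {r β ε : ℝ} (hr : 0 < r) (hrΩ : Metric.ball x₀ r ⊆ Ω) (hε : 0 < ε) (hβ : β = 4 * ε / r)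
    (hβ1 : β ≤ 1 / 4) (hk : IsKernel k ε C)
    {ρ : EuclideanSpace ℝ (Fin d) → EuclideanSpace ℝ (Fin d)} (hρ : ρ ∈ testFields Ω) :
    ∫ x, mollify k (dilate f x₀ β) x * div ρ x ≤ ((1 - β) ^ d)⁻¹ * (TV Ω f).toReal := by
  have hβ0 : 0 < β := by rw [hβ]; positivity
  obtain ⟨B, hB⟩ := exists_abs_div_le hρ.1 hρ.2.1
  have hF := hf.integrable_dilate x₀ (show β < 1 by linarith)
  have hint : Integrable (fun p : EuclideanSpace ℝ (Fin d) × EuclideanSpace ℝ (Fin d) =>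
      k p.2 * dilate f x₀ β (p.1 - p.2) * div ρ p.1) (volume.prod volume) :=
    (hk.integrable.convolution_integrand (ContinuousLinearMap.mul ℝ ℝ) hF).mul_bdd
      ((continuous_div hρ.1).comp continuous_fst).aestronglyMeasurable
      (Eventually.of_forall fun p => hB p.1)
  simp_rw [mollify_eq_integral_mul_sub, ← integral_mul_const]
  rw [integral_integral_swap hint]
  have h1 : ∀ z, ∫ x, k z * dilate f x₀ β (x - z) * div ρ x ≤
      k z * (((1 - β) ^ d)⁻¹ * (TV Ω f).toReal) := by
    intro z
    simp_rw [mul_assoc]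
    rw [integral_const_mul]
    rcases le_or_gt ε ‖z‖ with hz | hz
    · simp [hk.zero z hz]
    · refine mul_le_mul_of_nonneg_left ?_ (hk.nonneg z)
      have e : ∀ x, dilate f x₀ β (x - z) = f ((1 - β) • x + (β • x₀ - (1 - β) • z)) := fun x => by
        unfold dilate
        congr 1
        module
      simp_rw [e]
      refine integral_comp_smul_add_mul_div_le hf.zero hf.TV_ne_top (by linarith) (by linarith)
        (fun x hx => ?_) hρ
      have := hf.smul_add_mem hr hrΩ hε hβ hβ1 (w := -z) (by rw [norm_neg]; linarith) hx
      convert this using 1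
      module
  calc _ ≤ ∫ z, k z * (((1 - β) ^ d)⁻¹ * (TV Ω f).toReal) :=
        integral_mono hint.integral_prod_right (hk.integrable.mul_const _) h1
    _ = _ := by rw [integral_mul_const, hk.integral, one_mul]

end IsBoundedBV

/-! ### Piecewise Lipschitz functions and integration by parts -/

/-- A function on a convex set which is Lipschitz on each member of a finite closed cover is
Lipschitz: on a segment, every point has points of one of the pieces accumulating at it from the
right, which bounds a right slope. -/
lemma lipschitzOnWith_of_finite_cover {E : Type*} [NormedAddCommGroup E] [NormedSpace ℝ E]
    {𝒦 : Set (Set E)} (h𝒦 : 𝒦.Finite) (hcl : ∀ K ∈ 𝒦, IsClosed K) {D : Set E} (hD : Convex ℝ D)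
    (hcov : D ⊆ ⋃₀ 𝒦) {u : E → ℝ} {L : NNReal} (hL : ∀ K ∈ 𝒦, LipschitzOnWith L u K) :
    LipschitzOnWith L u D := by
  have hcont : ContinuousOn u (⋃₀ 𝒦) := by
    rw [Set.sUnion_eq_iUnion]
    have := h𝒦.to_subtype
    exact (locallyFinite_of_finite _).continuousOn_iUnion (fun K => hcl K K.2)
      fun K => (hL K K.2).continuousOn
  suffices h : ∀ x ∈ D, ∀ y ∈ D, u y ≤ u x + L * dist x y by
    refine LipschitzOnWith.of_le_add_mul L fun y hy x hx => ?_
    rw [dist_comm]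
    exact h x hx y hy
  intro x hx y hy
  set γ : ℝ → E := fun t => x + t • (y - x) with hγ
  have hγc : Continuous γ := by fun_prop
  have hγD : ∀ t ∈ Set.Icc (0 : ℝ) 1, γ t ∈ D := fun t ht =>
    hD.add_smul_sub_mem hx hy ht
  have hdist : ∀ s t, dist (γ s) (γ t) = |s - t| * dist x y := fun s t => by
    simp only [hγ, dist_eq_norm]
    rw [add_sub_add_left_eq_sub, ← sub_smul, norm_smul, Real.norm_eq_abs, norm_sub_rev y x]
  have key := image_le_of_liminf_slope_right_le_deriv_boundary (f := u ∘ γ) (a := 0) (b := 1)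
    (B := fun t => u x + L * dist x y * t) (B' := fun _ => L * dist x y) ?_ ?_ ?_ ?_ ?_
    (Set.right_mem_Icc.2 zero_le_one)
  · simpa [hγ] using key
  · exact (hcont.mono hcov).comp hγc.continuousOn hγD
  · simp [hγ]
  · fun_prop
  · intro t _
    simpa using (((hasDerivAt_id t).const_mul (L * dist x y)).const_add (u x)).hasDerivWithinAt
  · intro t ht r hr
    have hev : ∀ᶠ z in 𝓝[>] t, ∃ K ∈ 𝒦, γ z ∈ K := by
      filter_upwards [Ioc_mem_nhdsGT ht.2] with z hz
      exact hcov (hγD z ⟨ht.1.trans hz.1.le, hz.2⟩)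
    obtain ⟨K, hK, hfr⟩ : ∃ K ∈ 𝒦, ∃ᶠ z in 𝓝[>] t, γ z ∈ K := by
      by_contra! hcon
      have h1 : ∀ᶠ z in 𝓝[>] t, ∀ K ∈ 𝒦, γ z ∉ K :=
        (eventually_all_finite h𝒦).2 hcon
      obtain ⟨z, ⟨K, hK, hz⟩, hz'⟩ := (hev.and h1).exists
      exact hz' K hK hz
    have htK : γ t ∈ K :=
      (hcl K hK).mem_of_frequently_of_tendsto hfr (hγc.continuousWithinAt (s := Set.Ioi t) (x := t))
    refine (hfr.and_eventually self_mem_nhdsWithin).mono fun z ⟨hz, htz⟩ => lt_of_le_of_lt ?_ hr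
    have htz' : 0 < z - t := sub_pos.2 htz
    rw [slope_def_field, div_le_iff₀ htz']
    have := (hL K hK).dist_le_mul _ hz _ htK
    rw [hdist, abs_of_pos htz', Real.dist_eq] at this
    calc u (γ z) - u (γ t) ≤ _ := le_abs_self _
      _ ≤ _ := this
      _ = _ := by ring

/-- Integration by parts against a test field: for Lipschitz functions the pointwise gradient, which
exists almost everywhere, bounds the distributional one. -/
lemma integral_mul_div_le_of_lipschitzWith {e : EuclideanSpace ℝ (Fin d) → ℝ} {D : NNReal}
    (hΩ : MeasurableSet Ω) (he : LipschitzWith D e) {W : EuclideanSpace ℝ (Fin d) → ℝ}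
    (hW : IntegrableOn W Ω)
    (hWe : ∀ᵐ x ∂(volume.restrict Ω), ‖fderiv ℝ e x‖ ≤ W x)
    {ρ : EuclideanSpace ℝ (Fin d) → EuclideanSpace ℝ (Fin d)} (hρ : ρ ∈ testFields Ω) :
    ∫ x, e x * div ρ x ≤ ∫ x in Ω, W x := by
  obtain ⟨h1, h2, h3, h4⟩ := hρ
  have hρi : ∀ i, ContDiff ℝ 1 fun x => ρ x i := fun i => by fun_prop
  have hρc : ∀ i, HasCompactSupport fun x => ρ x i := fun i =>
    h2.comp_left (g := fun v : EuclideanSpace ℝ (Fin d) => v i) rfl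
  have hdiv : ∀ x i, lineDeriv ℝ (fun x => ρ x i) x (-(EuclideanSpace.single i 1))
      = -(fderiv ℝ ρ x (EuclideanSpace.single i 1)) i := fun x i => by
    rw [((hρi i).differentiable one_ne_zero x).lineDeriv_eq_fderiv, map_neg]
    have h5 := (EuclideanSpace.proj (𝕜 := ℝ) i).hasFDerivAt.comp x
      (h1.differentiable one_ne_zero x).hasFDerivAt
    have h6 : fderiv ℝ (fun x => ρ x i) x = _ := h5.fderiv
    rw [h6]
    rfl
  have hfc := h1.continuous_fderiv one_ne_zero
  have hi1 : ∀ i, Integrable fun x => e x * (fderiv ℝ ρ x (EuclideanSpace.single i 1)) i := by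
    intro i
    refine (he.continuous.mul (by fun_prop)).integrable_of_hasCompactSupport ?_
    refine HasCompactSupport.mul_left (f := e) ?_
    exact (h2.fderiv_apply ℝ (EuclideanSpace.single i 1)).comp_left
      (g := fun v : EuclideanSpace ℝ (Fin d) => v i) rfl
  have hi2 : ∀ i, Integrable fun x => lineDeriv ℝ e x (EuclideanSpace.single i 1) * ρ x i :=
    fun i => (he.locallyIntegrable_lineDeriv _).integrable_smul_right_of_hasCompactSupport
      (hρi i).continuous (hρc i)
  have hparts : ∫ x, e x * div ρ x
      = -∫ x, ∑ i, lineDeriv ℝ e x (EuclideanSpace.single i 1) * ρ x i := by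
    rw [integral_finsetSum _ fun i _ => hi2 i]
    simp only [div, Finset.mul_sum]
    rw [integral_finsetSum _ fun i _ => hi1 i, ← Finset.sum_neg_distrib]
    refine Finset.sum_congr rfl fun i _ => ?_
    obtain ⟨D', hD'⟩ := (hρi i).lipschitzWith_of_hasCompactSupport (hρc i) one_ne_zero
    rw [he.integral_lineDeriv_mul_eq hD' (hρc i), ← integral_neg]
    refine integral_congr_ae (Eventually.of_forall fun x => ?_)
    simp only [hdiv]
    ring
  rw [hparts, ← integral_indicator hΩ, ← integral_neg]
  refine (le_abs_self _).trans ?_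
  rw [← Real.norm_eq_abs]
  refine norm_integral_le_of_norm_le (hW.integrable_indicator hΩ) ?_
  rw [ae_restrict_iff' hΩ] at hWe
  filter_upwards [hWe, he.ae_differentiableAt] with x hx hdx
  by_cases hxΩ : x ∈ Ω
  · rw [Set.indicator_of_mem hxΩ, norm_neg]
    have h5 : ∑ i, lineDeriv ℝ e x (EuclideanSpace.single i 1) * ρ x i = fderiv ℝ e x (ρ x) := by
      conv_rhs => rw [← (EuclideanSpace.basisFun (Fin d) ℝ).sum_repr (ρ x)]
      simp [map_sum, hdx.lineDeriv_eq_fderiv, mul_comm]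
    rw [h5]
    calc ‖fderiv ℝ e x (ρ x)‖ ≤ ‖fderiv ℝ e x‖ * ‖ρ x‖ := ContinuousLinearMap.le_opNorm _ _
      _ ≤ W x * 1 := by
        gcongr
        · exact (norm_nonneg _).trans (hx hxΩ)
        · exact hx hxΩ
        · exact h4 x
      _ = W x := mul_one _
  · have h5 : ρ x = 0 := image_eq_zero_of_notMem_tsupport fun h => hxΩ (h3 h)
    simp [h5, hxΩ]

/-! ### Nodal interpolation on a triangulation -/

/-- Prescribed values at the vertices of a nondegenerate simplex are interpolated by an affine
function. -/
lemma exists_affineMap_interpolating {s : Finset (EuclideanSpace ℝ (Fin d))}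
    (hs : AffineIndependent ℝ ((↑) : s → EuclideanSpace ℝ (Fin d))) (hcard : s.card = d + 1)
    (u : EuclideanSpace ℝ (Fin d) → ℝ) :
    ∃ g : EuclideanSpace ℝ (Fin d) →ᵃ[ℝ] ℝ, ∀ v ∈ s, g v = u v := by
  have htop : affineSpan ℝ (Set.range ((↑) : s → EuclideanSpace ℝ (Fin d))) = ⊤ := by
    rw [hs.affineSpan_eq_top_iff_card_eq_finrank_add_one]
    simp [hcard]
  let b : AffineBasis s ℝ (EuclideanSpace ℝ (Fin d)) := ⟨(↑), hs, htop⟩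
  refine ⟨∑ i : s, u i • b.coord i, fun v hv => ?_⟩
  have h1 : ∀ i : s, b.coord i v = if i = ⟨v, hv⟩ then 1 else 0 := fun i =>
    b.coord_apply i ⟨v, hv⟩
  have h2 : (∑ i : s, u i • b.coord i) v = ∑ i : s, u i * b.coord i v := by
    have : ∀ t : Finset s, (∑ i ∈ t, u i • b.coord i) v = ∑ i ∈ t, u i * b.coord i v := by
      intro t
      induction t using Finset.induction_on with
      | empty => simp
      | insert a t ha ih => rw [Finset.sum_insert ha, Finset.sum_insert ha, ← ih]; rfl
    exact this _
  rw [h2]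
  simp [h1]

lemma apply_eq_linear_add (g : EuclideanSpace ℝ (Fin d) →ᵃ[ℝ] ℝ) (y : EuclideanSpace ℝ (Fin d)) :
    g y = g.linear.toContinuousLinearMap y + g 0 :=
  congrFun g.decomp y

lemma eqOn_convexHull_of_eqOn {s : Set (EuclideanSpace ℝ (Fin d))}
    {g g' : EuclideanSpace ℝ (Fin d) →ᵃ[ℝ] ℝ} (h : Set.EqOn g g' s) :
    Set.EqOn g g' (convexHull ℝ s) := by
  have hc : Convex ℝ ((g - g') ⁻¹' {0}) := (convex_singleton (0 : ℝ)).affine_preimage (g - g')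
  intro x hx
  have := convexHull_min (fun y hy => by simp [h hy]) hc hx
  simpa [sub_eq_zero] using this

/-- `v` is the nodal interpolant of `u`: on each element it coincides with the affine function which
takes the values of `u` at the vertices. -/
def IsInterpolant (T : Triangulation Ω) (u v : EuclideanSpace ℝ (Fin d) → ℝ) : Prop :=
  ∀ s ∈ T.faces, s.card = d + 1 → ∃ g : EuclideanSpace ℝ (Fin d) →ᵃ[ℝ] ℝ,
    Set.EqOn v g (convexHull ℝ (s : Set (EuclideanSpace ℝ (Fin d)))) ∧ ∀ y ∈ s, g y = u y

/-- The affine interpolants on the elements fit together, because two elements meet in the convex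
hull of their common vertices. -/
lemma exists_isInterpolant (T : Triangulation Ω) (u : EuclideanSpace ℝ (Fin d) → ℝ) :
    ∃ v, IsInterpolant T u v := by
  classical
  have hg : ∀ s : {s // s ∈ T.faces ∧ s.card = d + 1}, ∃ g : EuclideanSpace ℝ (Fin d) →ᵃ[ℝ] ℝ,
      ∀ y ∈ s.1, g y = u y := fun s => exists_affineMap_interpolating (T.indep s.2.1) s.2.2 u
  choose g hg using hg
  refine ⟨fun x => if h : ∃ s : {s // s ∈ T.faces ∧ s.card = d + 1},
    x ∈ convexHull ℝ (s.1 : Set (EuclideanSpace ℝ (Fin d))) then g h.choose x else 0,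
    fun s hs hcard => ⟨g ⟨s, hs, hcard⟩, fun x hx => ?_, hg ⟨s, hs, hcard⟩⟩⟩
  have h : ∃ s : {s // s ∈ T.faces ∧ s.card = d + 1},
    x ∈ convexHull ℝ (s.1 : Set (EuclideanSpace ℝ (Fin d))) := ⟨⟨s, hs, hcard⟩, hx⟩
  simp only [dif_pos h]
  refine eqOn_convexHull_of_eqOn (fun y hy => ?_)
    (T.inter_subset_convexHull h.choose.2.1 hs ⟨h.choose_spec, hx⟩)
  rw [hg _ y hy.1, hg _ y hy.2]

lemma finite_elements (T : Triangulation Ω) : T.elements.Finite := by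
  refine (T.finite_faces.image fun s : Finset (EuclideanSpace ℝ (Fin d)) =>
    convexHull ℝ (s : Set (EuclideanSpace ℝ (Fin d)))).subset ?_
  rintro K ⟨s, hs, -, rfl⟩
  exact ⟨s, hs, rfl⟩

lemma isCompact_of_mem_elements {T : Triangulation Ω} {K : Set (EuclideanSpace ℝ (Fin d))}
    (hK : K ∈ T.elements) : IsCompact K := by
  obtain ⟨s, -, -, rfl⟩ := hK
  exact (s.finite_toSet.isCompact_convexHull (𝕜 := ℝ))

lemma sUnion_elements (T : Triangulation Ω) : ⋃₀ T.elements = closure Ω := by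
  rw [← T.space_eq]
  ext x
  simp only [Set.mem_sUnion, Geometry.SimplicialComplex.mem_space_iff]
  constructor
  · rintro ⟨K, ⟨s, hs, -, rfl⟩, hx⟩
    exact ⟨s, hs, hx⟩
  · rintro ⟨s, hs, hx⟩
    obtain ⟨t, ht, hst, hcard⟩ := T.pure s hs
    exact ⟨_, ⟨t, ht, hcard, rfl⟩, convexHull_mono (Finset.coe_subset.2 hst) hx⟩

namespace IsInterpolant

variable {T : Triangulation Ω} {u v : EuclideanSpace ℝ (Fin d) → ℝ}

lemma exists_lipschitzOnWith (hv : IsInterpolant T u v) (hΩ : Convex ℝ Ω) :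
    ∃ L, LipschitzOnWith L v (closure Ω) := by
  have h1 : ∀ K : T.elements, ∃ L, LipschitzOnWith L v K := by
    rintro ⟨K, s, hs, hcard, rfl⟩
    obtain ⟨g, hg, -⟩ := hv s hs hcard
    refine ⟨‖g.linear.toContinuousLinearMap‖₊, fun x hx y hy => ?_⟩
    rw [hg hx, hg hy, apply_eq_linear_add g x, apply_eq_linear_add g y, edist_add_right]
    exact g.linear.toContinuousLinearMap.lipschitz x y
  choose L hL using h1
  have := (finite_elements T).fintype
  refine ⟨∑ K, L K, ?_⟩
  refine lipschitzOnWith_of_finite_cover (finite_elements T)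
    (fun K hK => (isCompact_of_mem_elements hK).isClosed) hΩ.closure (sUnion_elements T).ge
    fun K hK => ?_
  exact (hL ⟨K, hK⟩).weaken
    (Finset.single_le_sum (f := L) (fun _ _ => zero_le) (Finset.mem_univ (⟨K, hK⟩ : T.elements)))

lemma mem_P1Space (hv : IsInterpolant T u v) (hΩ : Convex ℝ Ω) : v ∈ P1Space T := by
  obtain ⟨L, hL⟩ := hv.exists_lipschitzOnWith hΩ
  refine ⟨hL.continuousOn, ?_⟩
  rintro K ⟨s, hs, hcard, rfl⟩
  obtain ⟨g, hg, -⟩ := hv s hs hcard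
  exact ⟨g, hg⟩

/-- The interpolant takes its values in the convex hull of the values at nearby vertices. -/
lemma abs_sub_le (hv : IsInterpolant T u v) {h : ℝ} (hh : ∀ K ∈ T.elements, Metric.diam K ≤ h)
    {x : EuclideanSpace ℝ (Fin d)} (hx : x ∈ closure Ω) {a D : ℝ}
    (hD : ∀ y, ‖y - x‖ ≤ h → |u y - a| ≤ D) : |v x - a| ≤ D := by
  rw [← sUnion_elements T] at hx
  obtain ⟨K, hK, hxK⟩ := hx
  have hK' := hK
  obtain ⟨s, hs, hcard, rfl⟩ := hK'
  obtain ⟨g, hg, hgu⟩ := hv s hs hcard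
  have hc : Convex ℝ (g ⁻¹' Metric.closedBall a D) := (convex_closedBall a D).affine_preimage g
  have := convexHull_min (fun y hy => ?_) hc hxK
  · rw [hg hxK]
    exact this
  · rw [Set.mem_preimage, hgu y hy, Metric.mem_closedBall, Real.dist_eq]
    refine hD y ?_
    rw [← dist_eq_norm]
    exact (Metric.dist_le_diam_of_mem (isCompact_of_mem_elements hK).isBounded
      (subset_convexHull ℝ _ hy) hxK).trans (hh _ hK)

end IsInterpolant

/-- The gradient error of affine interpolation on a shape regular simplex. Mean values along the
edges bound the error functional on differences of points of the simplex, and shape regularity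
turns this into a bound on its norm. -/
lemma norm_fderiv_sub_linear_le {s : Finset (EuclideanSpace ℝ (Fin d))}
    {u : EuclideanSpace ℝ (Fin d) → ℝ} (hu : ContDiff ℝ 1 u)
    {g : EuclideanSpace ℝ (Fin d) →ᵃ[ℝ] ℝ} (hg : ∀ y ∈ s, g y = u y) {σ δ G : ℝ} (hσ : 0 < σ)
    (hδ : 0 < δ) (hG : 0 ≤ G)
    (hdiam : Metric.diam (convexHull ℝ (s : Set (EuclideanSpace ℝ (Fin d)))) = δ)
    {c : EuclideanSpace ℝ (Fin d)}
    (hc : Metric.closedBall c (σ * δ) ⊆ convexHull ℝ (s : Set (EuclideanSpace ℝ (Fin d))))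
    {x : EuclideanSpace ℝ (Fin d)}
    (hL : ∀ y, ‖y - x‖ ≤ δ → ‖fderiv ℝ u y - fderiv ℝ u x‖ ≤ G * ‖y - x‖)
    (hx : x ∈ convexHull ℝ (s : Set (EuclideanSpace ℝ (Fin d)))) :
    ‖fderiv ℝ u x - g.linear.toContinuousLinearMap‖ ≤ 2 * δ / σ * G := by
  set K := convexHull ℝ (s : Set (EuclideanSpace ℝ (Fin d))) with hK
  have hKb : Bornology.IsBounded K := (s.finite_toSet.isCompact_convexHull (𝕜 := ℝ)).isBounded
  have hdist : ∀ y ∈ K, ∀ z ∈ K, ‖y - z‖ ≤ δ := fun y hy z hz => by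
    rw [← hdiam, ← dist_eq_norm]
    exact Metric.dist_le_diam_of_mem hKb hy hz
  set ℓ := fderiv ℝ u x - g.linear.toContinuousLinearMap with hℓ
  have hsK : (s : Set (EuclideanSpace ℝ (Fin d))) ⊆ K := subset_convexHull ℝ _
  have hedge : ∀ y ∈ s, ∀ z ∈ s, |ℓ y - ℓ z| ≤ G * δ * δ := by
    intro y hy z hz
    have hconv : Convex ℝ K := convex_convexHull ℝ _
    have h1 := hconv.norm_image_sub_le_of_norm_fderiv_le'
      (𝕜 := ℝ) (f := u) (φ := fderiv ℝ u x) (C := G * δ)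
      (fun w _ => hu.differentiable one_ne_zero w)
      (fun w hw => (hL w (hdist w hw x hx)).trans
        (mul_le_mul_of_nonneg_left (hdist w hw x hx) hG)) (hsK hz) (hsK hy)
    have h2 : g.linear (y - z) = u y - u z := by
      rw [← hg y hy, ← hg z hz, ← vsub_eq_sub y z, AffineMap.linearMap_vsub, vsub_eq_sub]
    have h3 : ℓ y - ℓ z = -(u y - u z - fderiv ℝ u x (y - z)) := by
      rw [← map_sub, hℓ, sub_apply, LinearMap.coe_toContinuousLinearMap', h2]
      ring
    rw [h3, abs_neg]
    exact h1.trans (mul_le_mul_of_nonneg_left (hdist y (hsK hy) z (hsK hz)) (by positivity))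
  obtain ⟨v₀, hv₀⟩ : s.Nonempty := by
    rw [← Finset.coe_nonempty, ← convexHull_nonempty_iff (𝕜 := ℝ)]
    exact ⟨x, hx⟩
  have hhull : ∀ y ∈ K, |ℓ y - ℓ v₀| ≤ G * δ * δ := by
    intro y hy
    have h1 : Convex ℝ (ℓ ⁻¹' Metric.closedBall (ℓ v₀) (G * δ * δ)) :=
      (convex_closedBall _ _).linear_preimage ℓ.toLinearMap
    exact convexHull_min (fun z hz => hedge z hz v₀ hv₀) h1 hy
  refine ContinuousLinearMap.opNorm_le_bound _ (by positivity) fun w => ?_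
  rcases eq_or_ne w 0 with rfl | hw
  · simp
  have hw' : 0 < ‖w‖ := norm_pos_iff.2 hw
  have hmem : c + (σ * δ / ‖w‖) • w ∈ K := by
    apply hc
    rw [mem_closedBall_iff_norm, add_sub_cancel_left, norm_smul,
      Real.norm_of_nonneg (by positivity), div_mul_cancel₀ _ hw'.ne']
  have hcK : c ∈ K := hc (Metric.mem_closedBall_self (by positivity))
  have h1 := hhull _ hmem
  have h2 := hhull _ hcK
  have h3 : σ * δ / ‖w‖ * ℓ w = (ℓ (c + (σ * δ / ‖w‖) • w) - ℓ v₀) - (ℓ c - ℓ v₀) := by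
    rw [map_add, map_smul, smul_eq_mul]
    ring
  have h4 : σ * δ / ‖w‖ * |ℓ w| ≤ 2 * (G * δ * δ) := by
    rw [← abs_of_pos (show 0 < σ * δ / ‖w‖ by positivity), ← abs_mul, h3]
    exact (abs_sub _ _).trans (by linarith)
  rw [Real.norm_eq_abs]
  have h5 : 0 < σ * δ / ‖w‖ := by positivity
  refine le_of_mul_le_mul_left (h4.trans_eq ?_) h5
  field_simp

lemma diam_pos_of_mem_elements (hd : d ≠ 0) {T : Triangulation Ω}
    {K : Set (EuclideanSpace ℝ (Fin d))} (hK : K ∈ T.elements) : 0 < Metric.diam K := by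
  have hb := (isCompact_of_mem_elements hK).isBounded
  obtain ⟨s, -, hcard, rfl⟩ := hK
  obtain ⟨y, hy, z, hz, hyz⟩ := Finset.one_lt_card.1 (show 1 < s.card by omega)
  exact (dist_pos.2 hyz).trans_le
    (Metric.dist_le_diam_of_mem hb (subset_convexHull ℝ _ hy) (subset_convexHull ℝ _ hz))

/-- Almost every point of the domain is interior to an element. -/
lemma ae_exists_mem_interior (T : Triangulation Ω) :
    ∀ᵐ x ∂(volume : Measure (EuclideanSpace ℝ (Fin d))), x ∈ Ω →
      ∃ K ∈ T.elements, x ∈ interior K := by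
  have h1 : ∀ᵐ x ∂(volume : Measure (EuclideanSpace ℝ (Fin d))), ∀ K ∈ T.elements,
      x ∉ frontier K := by
    rw [ae_ball_iff (finite_elements T).countable]
    rintro K ⟨s, -, -, rfl⟩
    exact measure_eq_zero_iff_ae_notMem.1 ((convex_convexHull ℝ _).addHaar_frontier volume)
  filter_upwards [h1] with x hx hxΩ
  have h2 : x ∈ ⋃₀ T.elements := by
    rw [sUnion_elements]
    exact subset_closure hxΩ
  obtain ⟨K, hK, hxK⟩ := h2
  refine ⟨K, hK, ?_⟩
  by_contra h3
  exact hx K hK ⟨subset_closure hxK, h3⟩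

/-- Replacing a smooth function by its nodal interpolant increases the total variation at most by
the mesh size times the integral of a local Lipschitz constant of the gradient. -/
lemma IsInterpolant.integral_mul_div_le {T : Triangulation Ω}
    {u v : EuclideanSpace ℝ (Fin d) → ℝ} (hv : IsInterpolant T u v) (hd : d ≠ 0) (hΩo : IsOpen Ω)
    (hΩ : Convex ℝ Ω) {h σ : ℝ} (hσ : 0 < σ) (hh : ∀ K ∈ T.elements, Metric.diam K ≤ h)
    (hreg : ∀ K ∈ T.elements, ∃ x, Metric.closedBall x (σ * Metric.diam K) ⊆ K)
    (hu : ContDiff ℝ 1 u) {D : NNReal} (huD : LipschitzWith D u)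
    {G : EuclideanSpace ℝ (Fin d) → ℝ} (hG0 : ∀ x, 0 ≤ G x) (hG : IntegrableOn G Ω)
    (hL : ∀ x ∈ Ω, ∀ y, ‖y - x‖ ≤ h → ‖fderiv ℝ u y - fderiv ℝ u x‖ ≤ G x * ‖y - x‖)
    {ρ : EuclideanSpace ℝ (Fin d) → EuclideanSpace ℝ (Fin d)} (hρ : ρ ∈ testFields Ω) :
    ∫ x in Ω, v x * div ρ x ≤ (∫ x, u x * div ρ x) + 2 * h / σ * ∫ x in Ω, G x := by
  obtain ⟨L, hvL⟩ := hv.exists_lipschitzOnWith hΩ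
  -- a globally Lipschitz extension, which allows integrating by parts on the whole space
  obtain ⟨w, hw, hwv⟩ := hvL.extend_real
  have hdivc := continuous_div hρ.1
  have hdivs := hasCompactSupport_div hρ.2.1
  have hdiv0 : ∀ x ∉ Ω, div ρ x = 0 := fun x hx => div_eq_zero_of_notMem fun h => hx (hρ.2.2.1 h)
  have h1 : ∫ x in Ω, v x * div ρ x = ∫ x, w x * div ρ x := by
    rw [← setIntegral_eq_integral_of_forall_compl_eq_zero (s := Ω)
      (f := fun x => w x * div ρ x) (fun x hx => by rw [hdiv0 x hx, mul_zero])]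
    refine setIntegral_congr_fun hΩo.measurableSet fun x hx => ?_
    simp only [hwv (subset_closure hx)]
  have h2 : ∫ x, (w - u) x * div ρ x = (∫ x, w x * div ρ x) - ∫ x, u x * div ρ x := by
    have h3 : ∀ w : EuclideanSpace ℝ (Fin d) → ℝ, Continuous w →
        Integrable fun x => w x * div ρ x := fun w hw =>
      (hw.mul hdivc).integrable_of_hasCompactSupport (hdivs.mul_left (f := w))
    simp only [Pi.sub_apply, sub_mul]
    exact integral_sub (h3 w hw.continuous) (h3 u huD.continuous)
  have h3 := integral_mul_div_le_of_lipschitzWith hΩo.measurableSet (hw.sub huD)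
    (hG.const_mul (2 * h / σ)) ?_ hρ
  · rw [integral_const_mul] at h3
    have h4 : ∫ x, (w - u) x * div ρ x ≤ 2 * h / σ * ∫ x in Ω, G x := h3
    linarith
  rw [ae_restrict_iff' hΩo.measurableSet]
  filter_upwards [ae_exists_mem_interior T] with x hx hxΩ
  obtain ⟨K, hK, hxK⟩ := hx hxΩ
  have hKΩ : K ⊆ closure Ω := by
    rw [← sUnion_elements T]
    exact Set.subset_sUnion_of_mem hK
  have hδ := diam_pos_of_mem_elements hd hK
  have hδh := hh K hK
  obtain ⟨c, hc⟩ := hreg K hK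
  obtain ⟨s, hs, hcard, rfl⟩ := hK
  obtain ⟨g, hg, hgu⟩ := hv s hs hcard
  have hgd : HasFDerivAt w g.linear.toContinuousLinearMap x := by
    have h5 : HasFDerivAt g g.linear.toContinuousLinearMap x := by
      rw [show (g : EuclideanSpace ℝ (Fin d) → ℝ) = fun y => g.linear.toContinuousLinearMap y + g 0
        from funext (apply_eq_linear_add g)]
      exact g.linear.toContinuousLinearMap.hasFDerivAt.add_const _
    refine h5.congr_of_eventuallyEq ?_
    filter_upwards [mem_interior_iff_mem_nhds.1 hxK] with y hy
    rw [← hwv (hKΩ hy), hg hy]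
  have hud := (hu.differentiable one_ne_zero x).hasFDerivAt
  have h6 : fderiv ℝ (fun x => w x - u x) x = _ := (hgd.sub hud).fderiv
  rw [h6, norm_sub_rev]
  refine (norm_fderiv_sub_linear_le hu hgu hσ hδ (hG0 x) rfl hc
    (fun y hy => hL x hxΩ y (hy.trans hδh)) (interior_subset hxK)).trans ?_
  gcongr
  exact hG0 x

/-! ### Approximation at a fixed mesh size -/

/-- Every bounded function of bounded variation agrees almost everywhere with a representative
which is bounded everywhere and vanishes outside of the domain. -/
lemma exists_isBoundedBV (hΩ : IsConvexPolygonalDomain Ω) {f : EuclideanSpace ℝ (Fin d) → ℝ}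
    (hTV : TV Ω f ≠ ∞) (hf : MemLp f ∞ (volume.restrict Ω)) :
    ∃ g M, f =ᵐ[volume.restrict Ω] g ∧ IsBoundedBV Ω g M := by
  obtain ⟨-, S, hS⟩ := hΩ
  have hΩo : IsOpen Ω := hS ▸ isOpen_interior
  set M := (eLpNorm f ∞ (volume.restrict Ω)).toReal with hM
  have hM0 : 0 ≤ M := ENNReal.toReal_nonneg
  set g : EuclideanSpace ℝ (Fin d) → ℝ :=
    Ω.indicator fun x => max (-M) (min (hf.1.mk f x) M) with hg
  have hfg : f =ᵐ[volume.restrict Ω] g := by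
    have h1 : ∀ᵐ x ∂(volume.restrict Ω), |f x| ≤ M := by
      filter_upwards [ae_le_eLpNormEssSup (f := f) (μ := volume.restrict Ω)] with x hx
      rw [hM, ← Real.norm_eq_abs, ← toReal_enorm]
      exact ENNReal.toReal_mono hf.2.ne (by rwa [eLpNorm_exponent_top])
    filter_upwards [h1, hf.1.ae_eq_mk, ae_restrict_mem hΩo.measurableSet] with x hx hx' hxΩ
    rw [hg, Set.indicator_of_mem hxΩ, ← hx', min_eq_left (abs_le.1 hx).2,
      max_eq_right (abs_le.1 hx).1]
  refine ⟨g, M, hfg, hΩo, ?_, ?_, ?_, fun x => ?_, fun x hx => Set.indicator_of_notMem hx _, ?_⟩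
  · rw [hS]
    exact (S.finite_toSet.isCompact_convexHull (𝕜 := ℝ)).isBounded.subset interior_subset
  · rw [hS]
    exact (convex_convexHull ℝ _).interior
  · exact (measurable_const.max
      (hf.1.stronglyMeasurable_mk.measurable.min measurable_const)).indicator hΩo.measurableSet
  · by_cases hx : x ∈ Ω
    · rw [hg, Set.indicator_of_mem hx, abs_le]
      exact ⟨le_max_left _ _, max_le (by linarith) (min_le_right _ _)⟩
    · rw [hg, Set.indicator_of_notMem hx, abs_zero]
      exact hM0
  · rwa [← TV_congr hfg]

/-- For small `x`, the factor `(1 - x) ^ (-d)` is `1 + O(x)`. -/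
lemma inv_one_sub_pow_le {x : ℝ} (hx1 : x ≤ 1) (hdx : d * x ≤ 1 / 2) (hx0 : 0 ≤ x) :
    ((1 - x) ^ d)⁻¹ ≤ 1 + 2 * d * x := by
  have h1 : 1 - d * x ≤ (1 - x) ^ d := by
    have := one_add_mul_le_pow (show (-2 : ℝ) ≤ -x by linarith) d
    rw [← sub_eq_add_neg] at this
    linarith
  have h0 : 0 ≤ d * x := by positivity
  calc ((1 - x) ^ d)⁻¹ ≤ (1 - d * x)⁻¹ := by
        gcongr
        linarith
    _ ≤ 1 + 2 * d * x := by
        rw [inv_le_iff_one_le_mul₀ (by linarith)]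
        nlinarith

/-- Nodal interpolation of the mollification at scale `ε` of a slight dilation of `f`, on a mesh
whose elements have diameter at most `h < ε`. -/
lemma IsBoundedBV.exists_mem_P1Space {f : EuclideanSpace ℝ (Fin d) → ℝ} {M : ℝ}
    (hf : IsBoundedBV Ω f M) (hne : Ω.Nonempty) (hd : d ≠ 0) {σ : ℝ} (hσ : 0 < σ) :
    ∃ C : ℝ, 0 < C ∧ ∃ ε₀ : ℝ, 0 < ε₀ ∧ ε₀ ≤ 1 ∧ ∀ (T : Triangulation Ω) (h ε : ℝ), 0 < h → h < ε →
      ε ≤ ε₀ → (∀ K ∈ T.elements, Metric.diam K ≤ h) →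
      (∀ K ∈ T.elements, ∃ x, Metric.closedBall x (σ * Metric.diam K) ⊆ K) →
      ∃ v ∈ P1Space T, (∀ x ∈ Ω, |v x - f x| ≤ 2 * M) ∧ ∫ x in Ω, |v x - f x| ≤ C * ε ∧
        TV Ω v ≤ TV Ω f + ENNReal.ofReal (C * (ε + h / ε)) := by
  obtain ⟨x₀, hx₀⟩ := hne
  obtain ⟨r, hr, hrΩ⟩ := Metric.isOpen_iff.1 hf.isOpen x₀ hx₀
  obtain ⟨R, hR, hRΩ⟩ := hf.isBounded.subset_closedBall_lt 0 x₀
  obtain ⟨C₁, hC₁, hkernel⟩ := exists_isKernel d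
  set V := (TV Ω f).toReal with hV
  have hV0 : 0 ≤ V := ENNReal.toReal_nonneg
  set C₂ := 2 ^ d * 2 ^ d * (4 * R / r + 2) *
        (volume (Metric.ball (0 : EuclideanSpace ℝ (Fin d)) 1)).toReal * V with hC₂
  have hC₂0 : 0 ≤ C₂ := by positivity
  refine ⟨C₁ * C₂ + 8 * d * V / r + 2 * C₁ * C₂ / σ + 1, by positivity,
    min 1 (r / (16 * (d + 1))), by positivity, min_le_left _ _, ?_⟩
  intro T h ε hh hhε hε₀ hdiam hreg
  have hε : 0 < ε := hh.trans hhε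
  set β := 4 * ε / r with hβ
  have hβ0 : 0 ≤ β := by positivity
  have hβd : (d + 1) * β ≤ 1 / 4 := by
    have h1 := hε₀.trans (min_le_right _ _)
    rw [le_div_iff₀ (by positivity)] at h1
    rw [hβ, ← mul_div_assoc, div_le_iff₀ hr]
    linarith
  have hβd0 : 0 ≤ d * β := by positivity
  have hβ1 : β ≤ 1 / 4 := by linarith
  obtain ⟨k, hk⟩ := hkernel ε hε
  set F := dilate f x₀ β with hF
  have hFi : Integrable F := hf.integrable_dilate x₀ (by linarith)
  have hFl : LocallyIntegrable F := hFi.locallyIntegrable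
  set A := oscillation f x₀ β (2 * ε) with hA
  have hA0 : ∀ x, 0 ≤ A x := oscillation_nonneg f x₀ β (2 * ε)
  have hAi : IntegrableOn A Ω := hf.integrableOn_oscillation x₀ β (2 * ε)
  have hAint : ∫ x in Ω, A x ≤ C₂ * ε ^ (d + 1) :=
    hf.setIntegral_oscillation_le hr hR hrΩ hRΩ hε hβ hβ1
  set u := mollify k F with hu
  have huC : ContDiff ℝ 1 u := contDiff_mollify hk.contDiff hk.hasCompactSupport hFl
  obtain ⟨D, huD⟩ := hk.exists_lipschitzWith_mollify hFi
  have huM : ∀ y, |u y| ≤ M := abs_mollify_le hk.nonneg hk.integrable hk.integral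
    fun z => hf.abs_le _
  obtain ⟨v, hv⟩ := exists_isInterpolant T u
  have hvP := hv.mem_P1Space hf.convex
  have hvM : ∀ x ∈ Ω, |v x - f x| ≤ 2 * M := fun x hx =>
    hv.abs_sub_le hdiam (subset_closure hx) fun y _ =>
      (abs_sub _ _).trans (by linarith [huM y, hf.abs_le x])
  have hvA : ∀ x ∈ Ω, |v x - f x| ≤ C₁ * (ε ^ d)⁻¹ * A x := fun x hx =>
    hv.abs_sub_le hdiam (subset_closure hx) fun y hy =>
      hk.abs_mollify_sub_le hFl (hy.trans hhε.le) (f x)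
  have hvi : IntegrableOn (fun x => |v x - f x|) Ω := by
    refine (Integrable.sub ?_ hf.integrable.integrableOn).abs
    exact ((hvP.1.integrableOn_compact hf.isBounded.isCompact_closure).mono_set subset_closure)
  refine ⟨v, hvP, hvM, ?_, ?_⟩
  · calc ∫ x in Ω, |v x - f x| ≤ ∫ x in Ω, C₁ * (ε ^ d)⁻¹ * A x :=
          setIntegral_mono_on hvi (hAi.const_mul _) hf.isOpen.measurableSet hvA
      _ = C₁ * (ε ^ d)⁻¹ * ∫ x in Ω, A x := integral_const_mul _ _
      _ ≤ C₁ * (ε ^ d)⁻¹ * (C₂ * ε ^ (d + 1)) := by gcongr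
      _ = C₁ * C₂ * ε := by
          rw [pow_succ]
          field_simp
      _ ≤ _ := by
          gcongr
          have h1 : 0 ≤ 8 * d * V / r := by positivity
          have h2 : 0 ≤ 2 * C₁ * C₂ / σ := by positivity
          linarith
  · rw [← ENNReal.ofReal_toReal hf.TV_ne_top, ← ENNReal.ofReal_add hV0 (by positivity)]
    refine TV_le_ofReal fun ρ hρ => ?_
    have h1 := hv.integral_mul_div_le hd hf.isOpen hf.convex hσ hdiam hreg huC huD
      (G := fun x => C₁ * (ε ^ (d + 2))⁻¹ * A x)
      (fun x => mul_nonneg (by positivity) (hA0 x)) (hAi.const_mul _)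
      (fun x _ y hy => hk.norm_fderiv_mollify_sub_le hC₁.le hε hFl (hy.trans_lt hhε)
        (by simpa using hε) (f x)) hρ
    have h2 := hf.integral_mollify_mul_div_le hr hrΩ hε hβ hβ1 hk hρ
    have h3 := inv_one_sub_pow_le (d := d) (by linarith : β ≤ 1) (by linarith) hβ0
    calc ∫ x in Ω, v x * div ρ x
        ≤ (1 + 2 * d * β) * V + 2 * h / σ * (C₁ * (ε ^ (d + 2))⁻¹ * (C₂ * ε ^ (d + 1))) := by
          refine h1.trans (add_le_add (h2.trans (mul_le_mul_of_nonneg_right h3 hV0)) ?_)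
          rw [integral_const_mul]
          gcongr
      _ = V + (8 * d * V / r * ε + 2 * C₁ * C₂ / σ * (h / ε)) := by
          rw [hβ, pow_add, pow_succ]
          field_simp
          ring
      _ ≤ _ := by
          gcongr
          rw [mul_add]
          have h4 : 0 ≤ 8 * d * V / r := by positivity
          have h5 : 0 ≤ 2 * C₁ * C₂ / σ := by positivity
          have h6 : 0 ≤ C₁ * C₂ := by positivity
          have h7 : 0 ≤ h / ε := by positivity
          gcongr <;> linarith

/-- Interpolation between `L¹` and `L^∞`, with a constant independent of `p`. -/
lemma eLpNorm_le_of_integral_abs_le {g : EuclideanSpace ℝ (Fin d) → ℝ}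
    {μ : Measure (EuclideanSpace ℝ (Fin d))} [IsFiniteMeasure μ]
    (hg : AEStronglyMeasurable g μ) {B I : ℝ} (hB : ∀ᵐ x ∂μ, |g x| ≤ B) (hB1 : 1 ≤ B)
    (hI : ∫ x, |g x| ∂μ ≤ I) {p : ℝ} (hp : 1 ≤ p) :
    eLpNorm g (ENNReal.ofReal p) μ ≤ ENNReal.ofReal (B * I ^ (1 / p)) := by
  have hp0 : 0 < p := by linarith
  have hm : ∀ q, MemLp g q μ := fun q => MemLp.of_bound hg B hB
  rw [(hm _).eLpNorm_eq_integral_rpow_norm (by simpa using hp0) ENNReal.ofReal_ne_top,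
    ENNReal.toReal_ofReal hp0.le]
  apply ENNReal.ofReal_le_ofReal
  have hi : Integrable (fun x => |g x|) μ := ((memLp_one_iff_integrable).1 (hm 1)).abs
  have h1 : ∫ x, ‖g x‖ ^ p ∂μ ≤ B ^ p * I := by
    refine le_trans (integral_mono_of_nonneg (g := fun x => B ^ p * |g x|)
      (Eventually.of_forall fun x => by positivity) (hi.const_mul _) ?_) ?_
    · filter_upwards [hB] with x hx
      rcases (abs_nonneg (g x)).eq_or_lt with h0 | h0
      · simp [← h0, hp0.ne']
      · calc |g x| ^ p = |g x| ^ (p - 1) * |g x| := by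
              rw [Real.rpow_sub_one h0.ne', div_mul_cancel₀ _ h0.ne']
          _ ≤ B ^ p * |g x| := by
              gcongr
              exact (Real.rpow_le_rpow h0.le hx (by linarith)).trans
                (Real.rpow_le_rpow_of_exponent_le hB1 (by linarith))
    · rw [integral_const_mul]
      gcongr
  have hI0 : 0 ≤ I := (integral_nonneg fun _ => abs_nonneg _).trans hI
  have hB0 : 0 ≤ B := by linarith
  calc (∫ x, ‖g x‖ ^ p ∂μ) ^ p⁻¹ ≤ (B ^ p * I) ^ p⁻¹ := by
        gcongr
    _ = B * I ^ (1 / p) := by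
        rw [Real.mul_rpow (by positivity) hI0, Real.rpow_rpow_inv hB0 hp0.ne', one_div]

lemma TV_zero : TV Ω 0 = 0 := by
  simp [TV]

lemma zero_mem_P1Space (T : Triangulation Ω) : (0 : EuclideanSpace ℝ (Fin d) → ℝ) ∈ P1Space T :=
  ⟨continuousOn_const, fun _ _ => ⟨0, fun _ _ => rfl⟩⟩

lemma rpow_one_div_le_max {x p : ℝ} (hx : 0 ≤ x) (hp : 1 ≤ p) : x ^ (1 / p) ≤ max 1 x := by
  have h1 : 0 ≤ 1 / p := by positivity
  have h2 : 1 / p ≤ 1 := by rw [div_le_one (by linarith)]; exact hp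
  calc x ^ (1 / p) ≤ (max 1 x) ^ (1 / p) := Real.rpow_le_rpow hx (le_max_right _ _) h1
    _ ≤ (max 1 x) ^ (1 : ℝ) := Real.rpow_le_rpow_of_exponent_le (le_max_left _ _) h2
    _ = max 1 x := Real.rpow_one _

lemma min_le_rpow_one_div {m x p : ℝ} (hm : 0 < m) (hm1 : m ≤ 1) (hmx : m ≤ x) (hp : 1 ≤ p) :
    m ≤ x ^ (1 / p) := by
  have h1 : 0 ≤ 1 / p := by positivity
  have h2 : 1 / p ≤ 1 := by rw [div_le_one (by linarith)]; exact hp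
  calc m = m ^ (1 : ℝ) := (Real.rpow_one m).symm
    _ ≤ m ^ (1 / p) := Real.rpow_le_rpow_of_exponent_ge hm hm1 h2
    _ ≤ x ^ (1 / p) := Real.rpow_le_rpow hm.le hmx h1

/-- Approximation with constants independent of `p`, the mesh size `h` and the scale `ε`. If
`h < ε ≤ ε₀` fails, the zero function is used: then only the trivial bound is available, and it
suffices because `ε` is bounded below in the situations of interest. -/
lemma exists_mem_P1Space_eLpNorm_le (hΩ : IsConvexPolygonalDomain Ω) (hd : d ≠ 0)
    {f : EuclideanSpace ℝ (Fin d) → ℝ} (hTV : TV Ω f ≠ ∞) (hf : MemLp f ∞ (volume.restrict Ω))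
    {σ : ℝ} (hσ : 0 < σ) :
    ∃ C : ℝ, 0 < C ∧ ∃ ε₀ : ℝ, 0 < ε₀ ∧ ε₀ ≤ 1 ∧ ∀ (T : Triangulation Ω) (h ε : ℝ), 0 < h →
      (∀ K ∈ T.elements, Metric.diam K ≤ h) →
      (∀ K ∈ T.elements, ∃ x, Metric.closedBall x (σ * Metric.diam K) ⊆ K) →
      ∃ v ∈ P1Space T, TV Ω v ≤ TV Ω f + ENNReal.ofReal (C * (ε + h / ε)) ∧
        (h < ε → ε ≤ ε₀ → IntegrableOn v Ω ∧ ∫ x in Ω, |v x - f x| ≤ C * ε ∧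
          ∀ p : ℝ, 1 ≤ p → eLpNorm (v - f) (ENNReal.ofReal p) (volume.restrict Ω) ≤
            ENNReal.ofReal (C * ε ^ (1 / p))) ∧
        (¬(h < ε ∧ ε ≤ ε₀) → ∀ p : ℝ, 1 ≤ p →
          eLpNorm (v - f) (ENNReal.ofReal p) (volume.restrict Ω) ≤ ENNReal.ofReal C) := by
  obtain ⟨g, M, hfg, hg⟩ := exists_isBoundedBV hΩ hTV hf
  have : IsFiniteMeasure (volume.restrict Ω) := ⟨by simpa using hg.isBounded.measure_lt_top⟩
  obtain ⟨C₁, hC₁, ε₀, hε₀, hε₁, H⟩ := hg.exists_mem_P1Space hΩ.1 hd hσ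
  have hM := hg.nonneg
  set J := M * (volume Ω).toReal with hJ
  have hJ0 : 0 ≤ J := by positivity
  set C := C₁ + max 1 (2 * M) * max 1 C₁ + max 1 M * max 1 J with hC
  have hm1 : 0 ≤ max 1 (2 * M) * max 1 C₁ := by positivity
  have hm2 : 0 ≤ max 1 M * max 1 J := by positivity
  refine ⟨C, by positivity, ε₀, hε₀, hε₁, fun T h ε hh hdiam hreg => ?_⟩
  by_cases hgood : h < ε ∧ ε ≤ ε₀
  · have hε : 0 < ε := hh.trans hgood.1
    obtain ⟨v, hvP, hvM, hvI, hvTV⟩ := H T h ε hh hgood.1 hgood.2 hdiam hreg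
    have hvi : IntegrableOn v Ω :=
      (hvP.1.integrableOn_compact hg.isBounded.isCompact_closure).mono_set subset_closure
    refine ⟨v, hvP, hvTV.trans ?_, fun _ _ => ⟨hvi, ?_, fun p hp => ?_⟩, fun h => (h hgood).elim⟩
    · rw [TV_congr hfg]
      gcongr
      linarith
    · have h1 : ∫ x in Ω, |v x - f x| = ∫ x in Ω, |v x - g x| := by
        refine integral_congr_ae ?_
        filter_upwards [hfg] with x hx
        rw [hx]
      rw [h1]
      refine hvI.trans ?_
      gcongr
      linarith
    · have h1 : v - f =ᵐ[volume.restrict Ω] v - g := by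
        filter_upwards [hfg] with x hx
        simp [hx]
      rw [eLpNorm_congr_ae h1]
      refine (eLpNorm_le_of_integral_abs_le (B := max 1 (2 * M)) (I := C₁ * ε)
        (hvi.1.sub hg.measurable.aestronglyMeasurable) ?_ (le_max_left _ _) hvI hp).trans
        (ENNReal.ofReal_le_ofReal ?_)
      · filter_upwards [ae_restrict_mem hg.isOpen.measurableSet] with x hx
        exact (hvM x hx).trans (le_max_right _ _)
      · calc max 1 (2 * M) * (C₁ * ε) ^ (1 / p)
            = max 1 (2 * M) * C₁ ^ (1 / p) * ε ^ (1 / p) := by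
              rw [Real.mul_rpow hC₁.le hε.le, mul_assoc]
          _ ≤ max 1 (2 * M) * max 1 C₁ * ε ^ (1 / p) := by
              gcongr
              exact rpow_one_div_le_max hC₁.le hp
          _ ≤ C * ε ^ (1 / p) := by
              gcongr
              linarith
  · refine ⟨0, zero_mem_P1Space T, ?_, fun h1 h2 => (hgood ⟨h1, h2⟩).elim, fun _ p hp => ?_⟩
    · rw [TV_zero]
      exact zero_le
    · have h1 : 0 - f =ᵐ[volume.restrict Ω] 0 - g := by
        filter_upwards [hfg] with x hx
        simp [hx]
      rw [eLpNorm_congr_ae h1]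
      have h2 : ∀ x, |(0 - g) x| ≤ M := fun x => by simpa using hg.abs_le x
      refine (eLpNorm_le_of_integral_abs_le (B := max 1 M) (I := J)
        (aestronglyMeasurable_zero.sub hg.measurable.aestronglyMeasurable)
        (Eventually.of_forall fun x => (h2 x).trans (le_max_right _ _)) (le_max_left _ _)
        ?_ hp).trans (ENNReal.ofReal_le_ofReal ?_)
      · refine (integral_mono_of_nonneg (Eventually.of_forall fun _ => abs_nonneg _)
          (integrable_const M) (Eventually.of_forall h2)).trans_eq ?_
        simp [hJ, mul_comm, Measure.real]
      · calc max 1 M * J ^ (1 / p) ≤ max 1 M * max 1 J := by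
              gcongr
              exact rpow_one_div_le_max hJ0 hp
          _ ≤ C := by linarith

/-! ### The limit of the total variations -/

/-- Lower semicontinuity of the total variation under convergence in `L¹`. -/
lemma eventually_lt_TV {ι : Type*} {l : Filter ι} {v : ι → EuclideanSpace ℝ (Fin d) → ℝ}
    {f : EuclideanSpace ℝ (Fin d) → ℝ} (hf : IntegrableOn f Ω)
    (hv : ∀ᶠ i in l, IntegrableOn (v i) Ω)
    (hlim : Tendsto (fun i => ∫ x in Ω, |v i x - f x|) l (𝓝 0)) {a : ℝ≥0∞} (ha : a < TV Ω f) :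
    ∀ᶠ i in l, a < TV Ω (v i) := by
  obtain ⟨ρ, hρ⟩ := lt_iSup_iff.1 ha
  obtain ⟨hρT, hρa⟩ := lt_iSup_iff.1 hρ
  obtain ⟨B, hB⟩ := exists_abs_div_le hρT.1 hρT.2.1
  have hdiv := (continuous_div hρT.1).aestronglyMeasurable (μ := volume.restrict Ω)
  have h1 : Tendsto (fun i => ∫ x in Ω, v i x * div ρ x) l (𝓝 (∫ x in Ω, f x * div ρ x)) := by
    rw [tendsto_iff_dist_tendsto_zero]
    refine squeeze_zero' (Eventually.of_forall fun _ => dist_nonneg) ?_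
      (by simpa using hlim.mul_const B)
    filter_upwards [hv] with i hi
    have hb : ∀ᵐ x ∂(volume.restrict Ω), ‖div ρ x‖ ≤ B := Eventually.of_forall hB
    have e : (∫ x in Ω, v i x * div ρ x) - ∫ x in Ω, f x * div ρ x
        = ∫ x in Ω, (v i x - f x) * div ρ x := by
      simp only [sub_mul]
      exact (integral_sub (hi.mul_bdd hdiv hb) (hf.mul_bdd hdiv hb)).symm
    rw [Real.dist_eq, e, ← integral_mul_const, ← Real.norm_eq_abs]
    refine norm_integral_le_of_norm_le ((hi.sub hf).abs.mul_const B)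
      (Eventually.of_forall fun x => ?_)
    rw [norm_mul]
    exact mul_le_mul_of_nonneg_left (hB x) (abs_nonneg _)
  have h2 := (ENNReal.continuous_ofReal.tendsto _).comp h1
  filter_upwards [(tendsto_order.1 h2).1 a hρa] with i hi
  exact hi.trans_le (le_iSup₂ (f := fun ρ (_ : ρ ∈ testFields Ω) =>
    ENNReal.ofReal (∫ x in Ω, v i x * div ρ x)) ρ hρT)

lemma tendsto_mul_abs_log_nhdsGT_zero : Tendsto (fun h : ℝ => h * |Real.log h|) (𝓝[>] 0) (𝓝 0) := by
  have h1 : Tendsto (fun h : ℝ => |h * Real.log h|) (𝓝[>] 0) (𝓝 0) := by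
    have := (Real.continuous_mul_log.tendsto 0).mono_left (nhdsWithin_le_nhds (s := Set.Ioi 0))
    simpa using this.abs
  refine h1.congr' ?_
  filter_upwards [self_mem_nhdsWithin] with h hh
  rw [abs_mul, abs_of_pos hh]

lemma tendsto_div_mul_abs_log_nhdsGT_zero :
    Tendsto (fun h : ℝ => h / (h * |Real.log h|)) (𝓝[>] 0) (𝓝 0) := by
  have h1 : Tendsto (fun h : ℝ => |Real.log h|⁻¹) (𝓝[>] 0) (𝓝 0) :=
    (tendsto_abs_atBot_atTop.comp Real.tendsto_log_nhdsGT_zero).inv_tendsto_atTop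
  refine h1.congr' ?_
  filter_upwards [self_mem_nhdsWithin] with h hh
  rw [← div_div, div_self (ne_of_gt hh), one_div]

end BVApprox

theorem mainTheorem8 (d : ℕ) (hd : d = 1 ∨ d = 2)
    (Ω : Set (EuclideanSpace ℝ (Fin d))) (hΩ : BVApprox.IsConvexPolygonalDomain Ω)
    (H : Set ℝ) (T : ℝ → BVApprox.Triangulation Ω) (hT : BVApprox.IsRegularFamily H T)
    (f : EuclideanSpace ℝ (Fin d) → ℝ) (hfBV : BVApprox.MemBV Ω f)
    (hfinf : MemLp f ∞ (volume.restrict Ω)) :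
    (∃ c : ℝ, 0 < c ∧ ∀ p : ℝ, 1 ≤ p → ∀ h ∈ H, ∃ fh ∈ BVApprox.P1Space (T h),
      eLpNorm (fh - f) (ENNReal.ofReal p) (volume.restrict Ω)
          ≤ ENNReal.ofReal (c * h ^ (1 / (p + 1))) ∧
      BVApprox.TV Ω fh ≤ BVApprox.TV Ω f + ENNReal.ofReal (c * h ^ (1 / (p + 1)))) ∧
    (∀ h₀ : ℝ, 0 < h₀ → h₀ < 1 → ∃ c : ℝ, 0 < c ∧ ∀ p : ℝ, 1 ≤ p →
      ∃ fh : ℝ → EuclideanSpace ℝ (Fin d) → ℝ,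
        (∀ h ∈ H, fh h ∈ BVApprox.P1Space (T h)) ∧
        (∀ h ∈ H, h ≤ h₀ →
          eLpNorm (fh h - f) (ENNReal.ofReal p) (volume.restrict Ω)
            ≤ ENNReal.ofReal (c * (h * |Real.log h|) ^ (1 / p))) ∧
        Tendsto (fun h => BVApprox.TV Ω (fh h)) (𝓝[H] 0) (𝓝 (BVApprox.TV Ω f))) := by
  obtain ⟨σ, hσ, hreg⟩ := hT.shapeRegular
  have hdiam : ∀ h ∈ H, ∀ K ∈ (T h).elements, Metric.diam K ≤ h := fun h hh K hK =>
    (hT.meshSize h hh).2 (Set.mem_image_of_mem _ hK)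
  obtain ⟨C, hC, ε₀, hε₀, hε₁, approx⟩ := BVApprox.exists_mem_P1Space_eLpNorm_le hΩ
    (by omega : d ≠ 0) hfBV.2 hfinf hσ
  refine ⟨⟨2 * C / ε₀, by positivity, fun p hp h hh => ?_⟩, fun h₀ hh₀ hh₁ => ?_⟩
  · obtain ⟨h0, h1⟩ := hT.subset_Ioo hh
    -- this scale balances the `L^p` error `ε ^ (1 / p)` against the excess variation `h / ε`
    set ε := h ^ (p / (p + 1)) with hε
    have hp1 : 0 < p + 1 := by linarith
    have hq : p / (p + 1) < 1 := by rw [div_lt_one hp1]; linarith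
    have hhε : h < ε := by
      conv_lhs => rw [← Real.rpow_one h]
      exact Real.rpow_lt_rpow_of_exponent_gt h0 h1 hq
    have hε0 : 0 < ε := h0.trans hhε
    have e1 : ε ^ (1 / p) = h ^ (1 / (p + 1)) := by
      rw [hε, ← Real.rpow_mul h0.le]
      congr 1
      field_simp
    have e2 : h / ε = h ^ (1 / (p + 1)) := by
      rw [hε]
      conv_lhs => rw [← Real.rpow_one h, ← Real.rpow_mul h0.le, one_mul, ← Real.rpow_sub h0]
      congr 1
      field_simp
      ring
    have e3 : ε ≤ h ^ (1 / (p + 1)) := by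
      refine Real.rpow_le_rpow_of_exponent_ge h0 h1.le ?_
      gcongr
    obtain ⟨v, hvP, hvTV, hv1, hv2⟩ := approx (T h) h ε h0 (hdiam h hh) (hreg h hh)
    have hpos : 0 < h ^ (1 / (p + 1)) := by positivity
    have hC2 : 2 * C ≤ 2 * C / ε₀ := by
      rw [le_div_iff₀ hε₀]
      exact mul_le_of_le_one_right (by positivity) hε₁
    refine ⟨v, hvP, ?_, hvTV.trans ?_⟩
    · by_cases hg : ε ≤ ε₀
      · refine ((hv1 hhε hg).2.2 p hp).trans (ENNReal.ofReal_le_ofReal ?_)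
        rw [e1]
        gcongr
        linarith
      · refine (hv2 (fun h => hg h.2) p hp).trans (ENNReal.ofReal_le_ofReal ?_)
        have h2 := BVApprox.min_le_rpow_one_div hε₀ hε₁ (not_le.1 hg).le hp
        rw [e1] at h2
        rw [div_mul_eq_mul_div, le_div_iff₀ hε₀]
        nlinarith
    · refine add_le_add le_rfl (ENNReal.ofReal_le_ofReal ?_)
      rw [e2]
      calc C * (ε + h ^ (1 / (p + 1))) ≤ C * (h ^ (1 / (p + 1)) + h ^ (1 / (p + 1))) := by gcongr
        _ = 2 * C * h ^ (1 / (p + 1)) := by ring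
        _ ≤ _ := by gcongr
  · classical
    have hlog : 0 < |Real.log h₀| := abs_pos.2 (Real.log_neg hh₀ hh₁).ne
    set m := min ε₀ (Real.exp (-1) * |Real.log h₀|) with hm
    have hm0 : 0 < m := by positivity
    have hm1 : m ≤ 1 := (min_le_left _ _).trans hε₁
    have hCm : C ≤ C / m := by
      rw [le_div_iff₀ hm0]
      exact mul_le_of_le_one_right hC.le hm1
    have hex : ∀ h, ∃ v : EuclideanSpace ℝ (Fin d) → ℝ, h ∈ H → _ := fun h => by
      by_cases hh : h ∈ H
      · obtain ⟨v, hv⟩ := approx (T h) h (h * |Real.log h|) (hT.subset_Ioo hh).1 (hdiam h hh)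
          (hreg h hh)
        exact ⟨v, fun _ => hv⟩
      · exact ⟨0, fun h' => (hh h').elim⟩
    choose v hv using hex
    refine ⟨C / m, by positivity, fun p hp => ⟨v, fun h hh => (hv h hh).1, fun h hh hhh₀ => ?_, ?_⟩⟩
    · obtain ⟨h0, h1⟩ := hT.subset_Ioo hh
      obtain ⟨-, -, hv1, hv2⟩ := hv h hh
      by_cases hg : h < h * |Real.log h| ∧ h * |Real.log h| ≤ ε₀
      · refine ((hv1 hg.1 hg.2).2.2 p hp).trans (ENNReal.ofReal_le_ofReal ?_)
        gcongr
      · refine (hv2 hg p hp).trans (ENNReal.ofReal_le_ofReal ?_)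
        have hmle : m ≤ h * |Real.log h| := by
          by_cases hlt : h < h * |Real.log h|
          · exact (min_le_left _ _).trans (not_le.1 fun h' => hg ⟨hlt, h'⟩).le
          · -- here `|log h| ≤ 1`, so that `h` is bounded below by `exp (-1)`
            have h2 : |Real.log h| ≤ 1 := by
              by_contra hcon
              exact hlt (lt_mul_of_one_lt_right h0 (not_le.1 hcon))
            have h3 : Real.exp (-1) ≤ h := by
              rw [← Real.le_log_iff_exp_le h0]
              exact (abs_le.1 h2).1
            have h4 : |Real.log h₀| ≤ |Real.log h| := by
              rw [abs_of_neg (Real.log_neg hh₀ hh₁), abs_of_neg (Real.log_neg h0 h1)]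
              exact neg_le_neg (Real.log_le_log h0 hhh₀)
            refine (min_le_right _ _).trans ?_
            gcongr
        have h2 := BVApprox.min_le_rpow_one_div hm0 hm1 hmle hp
        rw [div_mul_eq_mul_div, le_div_iff₀ hm0]
        gcongr
    · have hle : 𝓝[H] (0 : ℝ) ≤ 𝓝[>] 0 := nhdsWithin_mono 0 fun h hh => (hT.subset_Ioo hh).1
      have ht1 := BVApprox.tendsto_mul_abs_log_nhdsGT_zero.mono_left hle
      have ht2 := BVApprox.tendsto_div_mul_abs_log_nhdsGT_zero.mono_left hle
      have hup : Tendsto (fun h => BVApprox.TV Ω f +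
          ENNReal.ofReal (C * (h * |Real.log h| + h / (h * |Real.log h|)))) (𝓝[H] 0)
          (𝓝 (BVApprox.TV Ω f)) := by
        have h1 := ENNReal.tendsto_ofReal ((ht1.add ht2).const_mul C)
        simpa using h1.const_add (BVApprox.TV Ω f)
      have hgood : ∀ᶠ h in 𝓝[H] (0 : ℝ), h ∈ H ∧ h < h * |Real.log h| ∧ h * |Real.log h| ≤ ε₀ := by
        have hlt : ∀ᶠ h in 𝓝[>] (0 : ℝ), 1 < |Real.log h| :=
          (tendsto_abs_atBot_atTop.comp Real.tendsto_log_nhdsGT_zero).eventually_gt_atTop 1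
        filter_upwards [self_mem_nhdsWithin, hle hlt, ht1.eventually (ge_mem_nhds hε₀)]
          with h hh h1 h2
        exact ⟨hh, lt_mul_of_one_lt_right (hT.subset_Ioo hh).1 h1, h2⟩
      refine tendsto_order.2 ⟨fun a ha => ?_, fun a ha => ?_⟩
      · refine BVApprox.eventually_lt_TV hfBV.1 ?_ ?_ ha
        · filter_upwards [hgood] with h hh
          exact ((hv h hh.1).2.2.1 hh.2.1 hh.2.2).1
        · refine squeeze_zero' (Eventually.of_forall fun _ => integral_nonneg fun _ => abs_nonneg _)
            ?_ (by simpa using ht1.const_mul C)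
          filter_upwards [hgood] with h hh
          exact ((hv h hh.1).2.2.1 hh.2.1 hh.2.2).2.1
      · filter_upwards [(tendsto_order.1 hup).2 a ha, self_mem_nhdsWithin] with h h1 hh
        exact (hv h hh).2.1.trans_lt h1
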